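/- Let $M$ be a closed surface of class $C^r$ with $r\ge 2$, equipped with a continuous Riemannian metric with norm $\|\cdot\|$, and let $f:M\to M$ be a $C^r$ diffeomorphism. Suppose there are sequences $(n_k^H)_{k\ge1}$, $(n_k^T)_{k\ge1}$ of positive integers with $n_k^H\to\infty$ and a sequence of points $(\zeta_k)_{k\ge1}$ of $M$ such that, with $n_k=n_k^H+n_k^T$, the following conditions hold. **DH.** $f^{n_k}(\zeta_k)=\zeta_{k+1}$ for every $k\ge1$, and $\lim_{k\to\infty} n_k^H/n_k=1$. **H.** There are an open set $K\subset M$ and a $C^r$ coordinate $(x,y)$ on $K$ in which $f(x,y)=(\lambda_s x,\lambda_u y)$ (for points of $K$ whose image lies in $K$), with constants $0<\lambda_s<1<\lambda_u$ and $\lambda_s\lambda_u^3<1$; and there is a nonempty closed set $K'\subset K$ such that $f^j(\zeta_k)\in K'$ for all $k\ge1$ and $0\le j\le n_k^H$. **QT.** Write $v^s=(1,0)$, $v^u=(0,1)$ in these coordinates and $\zeta_{k+1}'=f^{n_k^H}(\zeta_k)$. For every $k\ge1$, $Df^{n_k^T}(\zeta_{k+1}')v^u\in\mathbb R v^s$.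 Moreover there is $C_T>0$, independent of $k$, such that for every $k\ge 1$ and every vertical line segment $\gamma\subset K$ containing $\zeta_{k+1}'$ with $f^{n_k^T}(\gamma)\subset K$, $$|\pi^u(f^{n_k^T}(\gamma))|\le C_T\,|\pi^s(f^{n_k^T}(\gamma))|^2,$$ where $|\pi^s(A)|$ and $|\pi^u(A)|$ denote the lengths of the orthogonal projections, in the coordinates on $K$, of a connected set $A\subset K$ to a horizontal and to a vertical line, respectively. **OE.** There are real numbers $\alpha,\beta$ with $$1<\alpha<\beta<2,\quad \tfrac52\alpha-2-\tfrac1{\alpha\beta}<0,\quad \lambda_s\lambda_u^{\frac{9\beta-6}{2-\beta}}<1,\quad \lambda_u(\lambda_s\lambda_u^3)^{\alpha\beta-1}>1,$$ $$\lambda_s^{\frac12}\lambda_u^{\frac{6\beta}{2-\beta}-\frac3{2-\alpha}-\frac{9\beta-6}{2(2-\beta)}}<1,\quad \lambda_s\lambda_u^{\frac{7\alpha}2}>\lambda_s\lambda_u^{\frac{9\beta-6}{2-\beta}},\quad \bigl(\lambda_s\lambda_u^{\frac{7\alpha}2}\bigr)^{\alpha\beta}>\lambda_s\lambda_u^{\frac{9\beta-6}{2-\beta}},$$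 and there is a positive integer $n_0^H$ such that, for all indices $k\ge1$ of the form indicated, $n_{2p}^H=\lfloor n_0^H\alpha^p\beta^p\rfloor$ and $n_{2p+1}^H=\lfloor n_0^H\alpha^{p+1}\beta^p\rfloor$. Then there exist nonempty open sets $U\subset K$ and $V\subset\mathbb R^2$ such that, for all $x\in U$ and all nonzero $v\in V$ (where $v=(c^s,c^u)$ is identified with the tangent vector $c^sv^s+c^uv^u\in T_xM$ through the coordinates on $K$), the sequence $\frac1n\log\|Df^n(x)v\|$ does not converge as $n\to\infty$. More precisely, for all such $x$ and $v$, $$\liminf_{n\to\infty}\frac1n\log\|Df^n(x)v\|\le\frac{\alpha\log\lambda_u+\log\lambda_s}{1+\alpha}<\frac{\beta\log\lambda_u+\log\lambda_s}{1+\beta}\le\limsup_{n\to\infty}\frac1n\log\|Df^n(x)v\|.$$ -/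

import Mathlib

open Filter Topology Set
open scoped Manifold ContDiff

noncomputable section

namespace SurfaceReturns

/-- The coordinate plane `ℝ²`, with its Euclidean norm. -/
abbrev Plane := EuclideanSpace ℝ (Fin 2)

/-- The horizontal unit vector `v^s = (1, 0)`. -/
def vS : Plane := !₂[1, 0]

/-- The vertical unit vector `v^u = (0, 1)`. -/
def vU : Plane := !₂[0, 1]

/-- The tangent vector at `x` whose coordinates with respect to the chart `φ` are `c`, that is
`(dφ_x)⁻¹ c`. For `x` in the domain of `φ` this is the identification of `T_x M` with `ℝ²`. -/
def coordVector {M : Type*} [TopologicalSpace M] [ChartedSpace Plane M]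
    (φ : OpenPartialHomeomorph M Plane) (x : M) (c : Plane) : TangentSpace (𝓡 2) x :=
  (mfderiv (𝓡 2) (𝓡 2) φ x).inverse c

/-- The length of the orthogonal projection (in the coordinates `φ`) of a connected set `A` onto a
horizontal line. The projection is an interval, and it depends on the line only by a translation. -/
def horizontalExtent {M : Type*} [TopologicalSpace M]
    (φ : OpenPartialHomeomorph M Plane) (A : Set M) : ℝ :=
  Metric.diam ((fun z => φ z 0) '' A)

/-- The length of the orthogonal projection (in the coordinates `φ`) of a connected set `A` onto a
vertical line. -/
def verticalExtent {M : Type*} [TopologicalSpace M]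
    (φ : OpenPartialHomeomorph M Plane) (A : Set M) : ℝ :=
  Metric.diam ((fun z => φ z 1) '' A)

/-- The closed vertical segment `{x} × [a, b]` in the plane. -/
def verticalSegment (x a b : ℝ) : Set Plane := {p | p 0 = x ∧ p 1 ∈ Icc a b}

/-- Two sequences, indexed by `k ≥ 1`, of positive integers, the first one tending to infinity.
The values at `k = 0` play no role. -/
structure ReturnTimes (nH nT : ℕ → ℕ) : Prop where
  pos_H : ∀ k, 1 ≤ k → 0 < nH k
  pos_T : ∀ k, 1 ≤ k → 0 < nT k
  tendsto_H : Tendsto nH atTop atTop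

/-- Condition DH: dominance of hyperbolic return times. -/
structure DH {M : Type*} (f : M → M) (nH nT : ℕ → ℕ) (ζ : ℕ → M) : Prop where
  return_eq : ∀ k, 1 ≤ k → f^[nH k + nT k] (ζ k) = ζ (k + 1)
  ratio : Tendsto (fun k => (nH k : ℝ) / ((nH k + nT k : ℕ) : ℝ)) atTop (𝓝 1)

/-- Condition H: strongly dissipative hyperbolic region. The open set `K` is the domain `φ.source`
of the `C^r` coordinate `φ`; the linear formula for `f` is to hold wherever both the point and its
image lie in `K`, so that both have coordinates. -/
structure H {M : Type*} [TopologicalSpace M] [ChartedSpace Plane M] (r : WithTop ℕ∞)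
    (f : M → M) (φ : OpenPartialHomeomorph M Plane) (K' : Set M) (lamS lamU : ℝ)
    (nH : ℕ → ℕ) (ζ : ℕ → M) : Prop where
  chart : φ ∈ IsManifold.maximalAtlas (𝓡 2) r M
  linear : ∀ z ∈ φ.source, f z ∈ φ.source → φ (f z) = !₂[lamS * φ z 0, lamU * φ z 1]
  lamS_pos : 0 < lamS
  lamS_lt : lamS < 1
  lamU_gt : 1 < lamU
  dissipative : lamS * lamU ^ 3 < 1
  closed : IsClosed K'
  nonempty : K'.Nonempty
  subset : K' ⊆ φ.source
  stay : ∀ k, 1 ≤ k → ∀ j ≤ nH k, f^[j] (ζ k) ∈ K'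

/-- Condition QT: quadratic tangential return. With `ζ'_{k+1} = f^{n_k^H}(ζ_k)`, the derivative of
`f^{n_k^T}` at `ζ'_{k+1}` maps the vertical direction to the horizontal one, and vertical segments
`γ ⊆ K` through `ζ'_{k+1}` are mapped to curves that are quadratically flat in the vertical
direction (for all `γ` whose image lies in `K`, so that it can be projected in the coordinates). -/
structure QT {M : Type*} [TopologicalSpace M] [ChartedSpace Plane M]
    (f : M → M) (φ : OpenPartialHomeomorph M Plane)
    (nH nT : ℕ → ℕ) (ζ : ℕ → M) : Prop where
  tangency : ∀ k, 1 ≤ k → ∃ c : ℝ,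
    mfderiv (𝓡 2) (𝓡 2) (f^[nT k]) (f^[nH k] (ζ k)) (coordVector φ (f^[nH k] (ζ k)) vU) =
      c • coordVector φ (f^[nT k] (f^[nH k] (ζ k))) vS
  quadratic : ∃ CT : ℝ, 0 < CT ∧ ∀ k, 1 ≤ k → ∀ a b : ℝ, ∀ γ : Set M,
    φ (f^[nH k] (ζ k)) 1 ∈ Icc a b →
    verticalSegment (φ (f^[nH k] (ζ k)) 0) a b ⊆ φ.target →
    γ = φ.symm '' verticalSegment (φ (f^[nH k] (ζ k)) 0) a b →
    f^[nT k] '' γ ⊆ φ.source →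
    verticalExtent φ (f^[nT k] '' γ) ≤ CT * horizontalExtent φ (f^[nT k] '' γ) ^ 2

/-- Condition OE: oscillatory and exponential growth of return times. -/
structure OE (nH : ℕ → ℕ) (lamS lamU α β : ℝ) : Prop where
  one_lt : 1 < α
  lt : α < β
  lt_two : β < 2
  ineq₁ : 5 / 2 * α - 2 - 1 / (α * β) < 0
  ineq₂ : lamS * lamU ^ ((9 * β - 6) / (2 - β)) < 1
  ineq₃ : 1 < lamU * (lamS * lamU ^ 3) ^ (α * β - 1)
  ineq₄ : lamS ^ (1 / 2 : ℝ) *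
    lamU ^ (6 * β / (2 - β) - 3 / (2 - α) - (9 * β - 6) / (2 * (2 - β))) < 1
  ineq₅ : lamS * lamU ^ ((9 * β - 6) / (2 - β)) < lamS * lamU ^ (7 * α / 2)
  ineq₆ : lamS * lamU ^ ((9 * β - 6) / (2 - β)) < (lamS * lamU ^ (7 * α / 2)) ^ (α * β)
  growth : ∃ n₀ : ℕ, 0 < n₀ ∧
    (∀ p, 1 ≤ p → nH (2 * p) = ⌊(n₀ : ℝ) * α ^ p * β ^ p⌋₊) ∧
    (∀ p, nH (2 * p + 1) = ⌊(n₀ : ℝ) * α ^ (p + 1) * β ^ p⌋₊)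

/-- The finite-time exponent `(1/n) log ‖Df^n(x) v‖`, where `‖·‖` is the norm on tangent vectors
of the Riemannian metric `g`. -/
def finiteTimeExponent {M : Type*} [TopologicalSpace M] [ChartedSpace Plane M]
    [IsManifold (𝓡 2) 1 M]
    (g : Bundle.ContinuousRiemannianMetric Plane (fun x : M => TangentSpace (𝓡 2) x))
    (f : M → M) (x : M) (v : TangentSpace (𝓡 2) x) (n : ℕ) : ℝ :=
  Real.log (Real.sqrt (g.inner (f^[n] x)
    (mfderiv (𝓡 2) (𝓡 2) (f^[n]) x v) (mfderiv (𝓡 2) (𝓡 2) (f^[n]) x v))) / n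

end SurfaceReturns

end

open SurfaceReturns

/-!
The points `ζ k` carry a nested itinerary of small boxes. Write `N = nH k`, `σ = lamU`, `λ = lamS`
and `Q = L ^ nT k`, where `L` bounds the `C^2` size of one iterate of `f` and of its inverse in a
finite atlas. As `nT k = o(nH k)`, every power of `Q` is negligible against `σ ^ (ε N)`.

**Boxes.** In coordinates, `f^[nH k]` is `diag(λ ^ N, σ ^ N)` near `ζ k` (`iterate_eq_diagMap`), and the
following `nT k` iterates form a map `T` with `C^{1,1}` bounds `Q` (`exists_rep_iterate_bounds`) whose
derivative at the centre sends the vertical direction to the horizontal one. Take boxes of half-height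
`(λ / σ²) ^ N` and half-width `(λ / σ³) ^ (N / 2)` around `ζ k`. After `N` iterates such a box has size
about `(λ / σ) ^ N`; then `T` produces a horizontal extent `Q (λ / σ) ^ N`, and by tangency a vertical
extent of only `Q λ ^ N` times the half-width plus `Q (λ / σ) ^ (2 N)`. Since `λ σ³ < 1` and `nH` grows
by factors in `(1, 1.06)`, this fits into the next box (`GoodScale.box_inequalities`,
`exists_boxes`). So every point of one box visits all later boxes.

**Tangent vectors.** On these boxes the derivative of `T` is a matrix with rows `(a, c)` and `(d, e)`,
where `|c|` and `|d|` are at least `1 / (2 Q)` and `|e| ≤ 2 Q (λ / σ) ^ N` (`NearlyTurns`): it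
nearly exchanges the axes. Consider a vector `(h, u)` at an even return, with next time `N' = nH (k + 1)`.
The component `u` is expanded by `σ ^ N`, turned to the horizontal, contracted by `λ ^ N'`, and turned
back; up to powers of `Q`, this bounds the new vertical component from below as long as `(h, u)` is not too flat, a
condition which persists because `α < β` (`vector_growth`). On the other hand no vector grows by
more than `λ ^ N σ ^ N'` over the two returns, again up to powers of `Q`.

**Exponents.** The lower bound, evaluated just after the expansion at an even return, pairs each
contraction with an expansion `β` times as long, so the rate is at least
`(β log σ + log λ) / (1 + β)` along these times (`frequently_le_exponent`). The upper bound,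
evaluated at the even returns, pairs each contraction with an expansion `α` times as long, so the
rate is at most `(α log σ + log λ) / (1 + α)` there (`frequently_exponent_le`). At both kinds of
times the point is in a fixed compact part of the coordinate domain, where the Riemannian norm is
comparable with the Euclidean norm of the coordinates.
-/

namespace SurfaceReturns

/-! ### Quantitative `C^{1,1}` bounds for compositions -/

/-- `G` is differentiable on the ball of radius `R` about `w`, where its derivative is bounded by
`A` and is `B`-Lipschitz. -/
structure BoundedDeriv {E F : Type*} [NormedAddCommGroup E] [NormedSpace ℝ E]
    [NormedAddCommGroup F] [NormedSpace ℝ F] (G : E → F) (w : E) (R A B : ℝ) : Prop where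
  diff : ∀ z ∈ Metric.ball w R, DifferentiableAt ℝ G z
  bound : ∀ z ∈ Metric.ball w R, ‖fderiv ℝ G z‖ ≤ A
  lip : ∀ z ∈ Metric.ball w R, ∀ z' ∈ Metric.ball w R,
    ‖fderiv ℝ G z - fderiv ℝ G z'‖ ≤ B * ‖z - z'‖

section BoundedDeriv

variable {E F G : Type*} [NormedAddCommGroup E] [NormedSpace ℝ E]
  [NormedAddCommGroup F] [NormedSpace ℝ F] [NormedAddCommGroup G] [NormedSpace ℝ G]

lemma BoundedDeriv.mono {f : E → F} {w : E} {R A B R' A' B' : ℝ} (h : BoundedDeriv f w R A B)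
    (hR : R' ≤ R) (hA : A ≤ A') (hB : B ≤ B') : BoundedDeriv f w R' A' B' where
  diff z hz := h.diff z (Metric.ball_subset_ball hR hz)
  bound z hz := (h.bound z (Metric.ball_subset_ball hR hz)).trans hA
  lip z hz z' hz' := (h.lip z (Metric.ball_subset_ball hR hz) z'
    (Metric.ball_subset_ball hR hz')).trans (by gcongr)

lemma BoundedDeriv.norm_sub_le {f : E → F} {w : E} {R A B : ℝ} (h : BoundedDeriv f w R A B)
    {z z' : E} (hz : z ∈ Metric.ball w R) (hz' : z' ∈ Metric.ball w R) :
    ‖f z - f z'‖ ≤ A * ‖z - z'‖ :=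
  (convex_ball w R).norm_image_sub_le_of_norm_fderiv_le h.diff h.bound hz' hz

/-- First order Taylor estimate at the centre of the ball. -/
lemma BoundedDeriv.norm_sub_sub_le {f : E → F} {w : E} {R A B : ℝ} (h : BoundedDeriv f w R A B)
    (hB : 0 ≤ B) {z : E} (hz : z ∈ Metric.ball w R) :
    ‖f z - f w - fderiv ℝ f w (z - w)‖ ≤ B * ‖z - w‖ ^ 2 := by
  have hw : w ∈ Metric.ball w R := Metric.mem_ball_self (Metric.pos_of_mem_ball hz)
  have hsub : Metric.closedBall w ‖z - w‖ ⊆ Metric.ball w R :=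
    Metric.closedBall_subset_ball (by simpa [dist_eq_norm] using hz)
  have := (convex_closedBall w ‖z - w‖).norm_image_sub_le_of_norm_fderiv_le'
    (f := f) (φ := fderiv ℝ f w) (C := B * ‖z - w‖) (fun y hy => h.diff y (hsub hy))
    (fun y hy => (h.lip y (hsub hy) w hw).trans (by
      have : ‖y - w‖ ≤ ‖z - w‖ := by simpa [dist_eq_norm] using hy
      gcongr))
    (Metric.mem_closedBall_self (norm_nonneg _)) (y := z) (by simp [dist_eq_norm])
  calc _ ≤ _ := this
    _ = _ := by ring

lemma BoundedDeriv.comp {f : E → F} {g : F → G} {w : E} {R R' A B A' B' : ℝ}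
    (hg : BoundedDeriv g (f w) R' A' B') (hf : BoundedDeriv f w R A B)
    (hm : MapsTo f (Metric.ball w R) (Metric.ball (f w) R'))
    (hA : 0 ≤ A) (hA' : 0 ≤ A') (hB' : 0 ≤ B') :
    BoundedDeriv (g ∘ f) w R (A' * A) (A' * B + B' * A ^ 2) where
  diff z hz := (hg.diff _ (hm hz)).comp z (hf.diff z hz)
  bound z hz := by
    rw [fderiv_comp z (hg.diff _ (hm hz)) (hf.diff z hz)]
    exact (ContinuousLinearMap.opNorm_comp_le _ _).trans
      (mul_le_mul (hg.bound _ (hm hz)) (hf.bound z hz) (norm_nonneg _) hA')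
  lip z hz z' hz' := by
    rw [fderiv_comp z (hg.diff _ (hm hz)) (hf.diff z hz),
      fderiv_comp z' (hg.diff _ (hm hz')) (hf.diff z' hz')]
    have e : (fderiv ℝ g (f z)).comp (fderiv ℝ f z) - (fderiv ℝ g (f z')).comp (fderiv ℝ f z') =
        (fderiv ℝ g (f z)).comp (fderiv ℝ f z - fderiv ℝ f z') +
          (fderiv ℝ g (f z) - fderiv ℝ g (f z')).comp (fderiv ℝ f z') := by
      ext; simp
    rw [e]
    have h1 := hg.bound _ (hm hz)
    have h2 := hf.lip z hz z' hz'
    have h3 : ‖fderiv ℝ g (f z) - fderiv ℝ g (f z')‖ ≤ B' * (A * ‖z - z'‖) :=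
      (hg.lip _ (hm hz) _ (hm hz')).trans (by gcongr; exact hf.norm_sub_le hz hz')
    have h4 := hf.bound z' hz'
    calc _ ≤ A' * (B * ‖z - z'‖) + B' * (A * ‖z - z'‖) * A := by
          refine (norm_add_le _ _).trans (add_le_add ?_ ?_)
          · exact (ContinuousLinearMap.opNorm_comp_le _ _).trans
              (mul_le_mul h1 h2 (norm_nonneg _) hA')
          · exact (ContinuousLinearMap.opNorm_comp_le _ _).trans
              (mul_le_mul h3 h4 (norm_nonneg _) (by positivity))
      _ = _ := by ring

lemma BoundedDeriv.congr {f g : E → F} {w : E} {R A B : ℝ} (h : BoundedDeriv f w R A B)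
    (hfg : EqOn g f (Metric.ball w R)) : BoundedDeriv g w R A B := by
  have key : ∀ z ∈ Metric.ball w R, g =ᶠ[𝓝 z] f := fun z hz =>
    hfg.eventuallyEq_of_mem (Metric.isOpen_ball.mem_nhds hz)
  refine ⟨fun z hz => (h.diff z hz).congr_of_eventuallyEq (key z hz), fun z hz => ?_,
    fun z hz z' hz' => ?_⟩
  · rw [(key z hz).fderiv_eq]; exact h.bound z hz
  · rw [(key z hz).fderiv_eq, (key z' hz').fderiv_eq]; exact h.lip z hz z' hz'

lemma exists_norm_fderiv_le_of_isCompact {f : E → F} {O K : Set E} (hO : IsOpen O)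
    (hf : ContDiffOn ℝ 1 f O) (hK : IsCompact K) (hKO : K ⊆ O) :
    ∃ L, ∀ z ∈ K, ‖fderiv ℝ f z‖ ≤ L := by
  have h : ContDiffOn ℝ 0 (fderiv ℝ f) O := hf.fderiv_of_isOpen hO (by norm_num)
  exact hK.exists_bound_of_continuousOn (h.continuousOn.mono hKO)

/-- A `C^2` map has uniform `C^{1,1}` bounds on balls of a fixed radius centred in a compact
set. -/
lemma exists_boundedDeriv_of_isCompact [ProperSpace E] {f : E → F} {O C : Set E} (hO : IsOpen O)
    (hf : ContDiffOn ℝ 2 f O) (hC : IsCompact C) (hCO : C ⊆ O) :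
    ∃ ρ > 0, ∃ L, ∀ w ∈ C, Metric.ball w ρ ⊆ O ∧ BoundedDeriv f w ρ L L := by
  obtain ⟨ρ, hρ, hρO⟩ := hC.exists_cthickening_subset_open hO hCO
  have hK : IsCompact (Metric.cthickening ρ C) := hC.cthickening
  have h1 : ContDiffOn ℝ 1 (fderiv ℝ f) O := hf.fderiv_of_isOpen hO (by norm_num)
  obtain ⟨L₁, hL₁⟩ := exists_norm_fderiv_le_of_isCompact hO (hf.of_le (by norm_num)) hK hρO
  obtain ⟨L₂, hL₂⟩ := exists_norm_fderiv_le_of_isCompact hO h1 hK hρO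
  refine ⟨ρ, hρ, max L₁ L₂, fun w hw => ?_⟩
  have hb : Metric.ball w ρ ⊆ Metric.cthickening ρ C :=
    (Metric.ball_subset_thickening hw ρ).trans (Metric.thickening_subset_cthickening ρ C)
  refine ⟨hb.trans hρO, fun z hz => ?_, fun z hz => (hL₁ z (hb hz)).trans (le_max_left _ _),
    fun z hz z' hz' => ?_⟩
  · exact (hf.contDiffAt (hO.mem_nhds (hρO (hb hz)))).differentiableAt (by norm_num)
  · exact (convex_ball w ρ).norm_image_sub_le_of_norm_fderiv_le
      (fun y hy => (h1.contDiffAt (hO.mem_nhds (hρO (hb hy)))).differentiableAt (by norm_num))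
      (fun y hy => (hL₂ y (hb hy)).trans (le_max_right _ _)) hz' hz

end BoundedDeriv

/-! ### Coordinate representatives of iterates -/

section Representatives

variable {M : Type*} [TopologicalSpace M]

/-- The open set of those coordinates, with respect to the chart `e`, of points which `F` maps
into the domain of the chart `e'`. -/
def repDomain (e e' : OpenPartialHomeomorph M Plane) (F : M → M) : Set Plane :=
  e.target ∩ e.symm ⁻¹' (F ⁻¹' e'.source)

/-- The representative of `F` in the charts `e` and `e'`. It is meaningful on
`repDomain e e' F`. -/
def rep (e e' : OpenPartialHomeomorph M Plane) (F : M → M) : Plane → Plane :=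
  fun p => e' (F (e.symm p))

lemma isOpen_repDomain (e e' : OpenPartialHomeomorph M Plane) {F : M → M} (hF : Continuous F) :
    IsOpen (repDomain e e' F) :=
  e.isOpen_inter_preimage_symm (e'.open_source.preimage hF)

lemma mem_repDomain {e e' : OpenPartialHomeomorph M Plane} {F : M → M} {x : M}
    (hx : x ∈ e.source) (hF : F x ∈ e'.source) : e x ∈ repDomain e e' F :=
  ⟨e.map_source hx, by simpa [e.left_inv hx] using hF⟩

lemma rep_apply {e : OpenPartialHomeomorph M Plane} (e' : OpenPartialHomeomorph M Plane)
    (F : M → M) {x : M} (hx : x ∈ e.source) : rep e e' F (e x) = e' (F x) := by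
  simp [rep, e.left_inv hx]

lemma symm_rep {e e' : OpenPartialHomeomorph M Plane} {F : M → M} {p : Plane}
    (hp : p ∈ repDomain e e' F) : e'.symm (rep e e' F p) = F (e.symm p) :=
  e'.left_inv hp.2

variable [ChartedSpace Plane M]

lemma contDiffOn_rep {r : WithTop ℕ∞} {e e' : OpenPartialHomeomorph M Plane}
    (he : e ∈ IsManifold.maximalAtlas (𝓡 2) r M) (he' : e' ∈ IsManifold.maximalAtlas (𝓡 2) r M)
    {F : M → M} (hF : ContMDiff (𝓡 2) (𝓡 2) r F) :
    ContDiffOn ℝ r (rep e e' F) (repDomain e e' F) := by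
  have h : ContMDiffOn (𝓡 2) (𝓡 2) r (e' ∘ F ∘ e.symm) (repDomain e e' F) := by
    refine (contMDiffOn_of_mem_maximalAtlas he').comp (t := e'.source) ?_ (fun p hp => hp.2)
    exact hF.comp_contMDiffOn
      ((contMDiffOn_symm_of_mem_maximalAtlas he).mono inter_subset_left)
  exact contMDiffOn_iff_contDiffOn.1 h

/-- If `C i` are finitely many compact sets covering `M`, each in the domain of a chart `e i`, then
the representatives of the iterates of a `C^2` map between these charts have derivative bounds
which grow at most exponentially, on balls which shrink at most exponentially. -/
lemma exists_rep_iterate_bounds_of_cover {r : WithTop ℕ∞} (hr : 2 ≤ r) {ι : Type*} [Finite ι]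
    {e : ι → OpenPartialHomeomorph M Plane} {C : ι → Set M}
    (he : ∀ i, e i ∈ IsManifold.maximalAtlas (𝓡 2) r M)
    (hC : ∀ i, IsCompact (C i)) (hCe : ∀ i, C i ⊆ (e i).source) (hcov : ∀ x, ∃ i, x ∈ C i)
    {F : M → M} (hF : ContMDiff (𝓡 2) (𝓡 2) r F) [T2Space M] :
    ∃ ρ > 0, ∃ L : ℝ, 2 ≤ L ∧ ∀ n : ℕ, ∀ i j, ∀ w ∈ C i, F^[n + 1] w ∈ C j →
      Metric.ball (e i w) (ρ / L ^ n) ⊆ repDomain (e i) (e j) F^[n + 1] ∧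
      BoundedDeriv (rep (e i) (e j) F^[n + 1]) (e i w) (ρ / L ^ n) (L ^ (n + 1))
        (L ^ (3 * n + 1)) := by
  have hFc : Continuous F := hF.continuous
  have h1 : ∀ q : ι × ι, ∃ ρ > 0, ∃ L : ℝ, ∀ w ∈ C q.1, F w ∈ C q.2 →
      Metric.ball (e q.1 w) ρ ⊆ repDomain (e q.1) (e q.2) F ∧
      BoundedDeriv (rep (e q.1) (e q.2) F) (e q.1 w) ρ L L := by
    rintro ⟨i, j⟩
    have hK : IsCompact (e i '' (C i ∩ F ⁻¹' C j)) :=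
      ((hC i).inter_right ((hC j).isClosed.preimage hFc)).image_of_continuousOn
        ((e i).continuousOn.mono (inter_subset_left.trans (hCe i)))
    obtain ⟨ρ, hρ, L, h⟩ := exists_boundedDeriv_of_isCompact
      (isOpen_repDomain (e i) (e j) hFc) ((contDiffOn_rep (he i) (he j) hF).of_le hr) hK
      (by
        rintro _ ⟨x, ⟨hx, hx'⟩, rfl⟩
        exact mem_repDomain (hCe i hx) (hCe j hx'))
    exact ⟨ρ, hρ, L, fun w hw hw' => h _ (mem_image_of_mem _ ⟨hw, hw'⟩)⟩
  choose ρ₀ hρ₀ L₀ hL₀ using h1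
  obtain ⟨ρ, hρ, hρle⟩ : ∃ ρ > 0, ∀ q, ρ ≤ ρ₀ q := by
    rcases isEmpty_or_nonempty (ι × ι) with hι | hι
    · exact ⟨1, one_pos, fun q => hι.elim q⟩
    · obtain ⟨q, hq⟩ := Finite.exists_min ρ₀
      exact ⟨ρ₀ q, hρ₀ q, hq⟩
  obtain ⟨L, hL2, hLle⟩ : ∃ L : ℝ, 2 ≤ L ∧ ∀ q, L₀ q ≤ L := by
    obtain ⟨B, hB⟩ := (Set.finite_range L₀).bddAbove
    exact ⟨max 2 B, le_max_left _ _, fun q => (hB (mem_range_self q)).trans (le_max_right _ _)⟩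
  have hL0 : 0 < L := by linarith
  have hone : ∀ i j, ∀ w ∈ C i, F w ∈ C j →
      Metric.ball (e i w) ρ ⊆ repDomain (e i) (e j) F ∧
      BoundedDeriv (rep (e i) (e j) F) (e i w) ρ L L := fun i j w hw hw' =>
    ⟨(Metric.ball_subset_ball (hρle (i, j))).trans (hL₀ (i, j) w hw hw').1,
      (hL₀ (i, j) w hw hw').2.mono (hρle _) (hLle _) (hLle _)⟩
  refine ⟨ρ, hρ, L, hL2, fun n => ?_⟩
  -- Lipschitz bounds `B` of derivatives compose as `B ↦ L * B + L * (L ^ (n + 1)) ^ 2`.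
  induction n with
  | zero => simpa using hone
  | succ n ih =>
    intro i j w hw hw'
    rw [Function.iterate_succ_apply'] at hw'
    obtain ⟨l, hl⟩ := hcov (F^[n + 1] w)
    obtain ⟨hG1, hG2⟩ := ih i l w hw hl
    obtain ⟨hH1, hH2⟩ := hone l j _ hl hw'
    have hcent : rep (e i) (e l) F^[n + 1] (e i w) = e l (F^[n + 1] w) :=
      rep_apply _ _ (hCe i hw)
    have hrad : ρ / L ^ (n + 1) ≤ ρ / L ^ n := by
      gcongr
      · linarith
      · omega
    have hsub := Metric.ball_subset_ball (x := e i w) hrad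
    have hG2' := hG2.mono hrad le_rfl le_rfl
    have hmaps : MapsTo (rep (e i) (e l) F^[n + 1]) (Metric.ball (e i w) (ρ / L ^ (n + 1)))
        (Metric.ball (rep (e i) (e l) F^[n + 1] (e i w)) ρ) := by
      intro z hz
      have h := hG2'.norm_sub_le hz (Metric.mem_ball_self (by positivity))
      rw [Metric.mem_ball, dist_eq_norm] at hz ⊢
      calc _ ≤ _ := h
        _ < L ^ (n + 1) * (ρ / L ^ (n + 1)) := by gcongr
        _ = ρ := by field_simp
    have hEq : EqOn (rep (e i) (e j) F^[n + 1 + 1])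
        (rep (e l) (e j) F ∘ rep (e i) (e l) F^[n + 1])
        (Metric.ball (e i w) (ρ / L ^ (n + 1))) := by
      intro z hz
      have := symm_rep (hG1 (hsub hz))
      simp only [Function.comp_apply]
      rw [rep, rep, this, Function.iterate_succ_apply']
    constructor
    · intro z hz
      have h1 := hG1 (hsub hz)
      have h2 := hmaps hz
      rw [hcent] at h2
      have h3 := hH1 h2
      refine ⟨h1.1, ?_⟩
      have h4 := h3.2
      simp only [mem_preimage, symm_rep h1] at h4
      simpa only [mem_preimage, Function.iterate_succ_apply' F (n + 1)] using h4
    · rw [← hcent] at hH2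
      refine ((hH2.comp hG2' hmaps (by positivity) hL0.le hL0.le).congr hEq).mono le_rfl
        (by rw [pow_succ' L (n + 1)]) ?_
      have hL1 : 1 ≤ L := by linarith
      calc L * L ^ (3 * n + 1) + L * (L ^ (n + 1)) ^ 2
          = L ^ (3 * n + 2) + L ^ (2 * n + 3) := by ring
        _ ≤ L ^ (3 * n + 3) + L ^ (3 * n + 3) := by
            gcongr <;> first | exact hL1 | omega
        _ = 2 * L ^ (3 * n + 3) := by ring
        _ ≤ L * L ^ (3 * n + 3) := by gcongr
        _ = L ^ (3 * (n + 1) + 1) := by ring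

/-- On a compact surface, the coordinate representatives in a fixed chart of the iterates of a
`C^2` map, near orbit segments with both endpoints in a fixed compact set, have derivative
bounds growing at most exponentially. -/
lemma exists_rep_iterate_bounds [CompactSpace M] [T2Space M] {r : WithTop ℕ∞} (hr : 2 ≤ r)
    [IsManifold (𝓡 2) r M] {φ : OpenPartialHomeomorph M Plane}
    (hφ : φ ∈ IsManifold.maximalAtlas (𝓡 2) r M) {K : Set M} (hK : IsCompact K)
    (hKφ : K ⊆ φ.source) {F : M → M} (hF : ContMDiff (𝓡 2) (𝓡 2) r F) :
    ∃ L : ℝ, 1 ≤ L ∧ ∀ n : ℕ, 1 ≤ n → ∀ w ∈ K, F^[n] w ∈ K →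
      Metric.ball (φ w) (1 / L ^ n) ⊆ repDomain φ φ F^[n] ∧
      BoundedDeriv (rep φ φ F^[n]) (φ w) (1 / L ^ n) (L ^ n) (L ^ n) := by
  have hloc : ∀ x : M, ∃ s ∈ 𝓝 x, s ⊆ (chartAt Plane x).source ∧ IsCompact s := fun x =>
    local_compact_nhds ((chartAt Plane x).open_source.mem_nhds (mem_chart_source Plane x))
  choose s hs hsub hsc using hloc
  obtain ⟨t, -, ht⟩ := isCompact_univ.elim_nhds_subcover s (fun x _ => hs x)
  obtain ⟨ρ, hρ, L, hL, h⟩ := exists_rep_iterate_bounds_of_cover hr (ι := Option t)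
    (e := fun i => i.elim φ fun p => chartAt Plane p.1) (C := fun i => i.elim K fun p => s p.1)
    (by rintro (_ | p)
        · exact hφ
        · exact IsManifold.chart_mem_maximalAtlas p.1)
    (by rintro (_ | p)
        · exact hK
        · exact hsc p.1)
    (by rintro (_ | p)
        · exact hKφ
        · exact hsub p.1)
    (fun x => by
      obtain ⟨p, hp, hx⟩ := mem_iUnion₂.1 (ht (mem_univ x))
      exact ⟨some ⟨p, hp⟩, hx⟩) hF
  set L₁ : ℝ := max L (1 / ρ) with hL₁
  have h1 : L ≤ L₁ := le_max_left _ _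
  have h2 : 1 / ρ ≤ L₁ := le_max_right _ _
  have hone : 1 ≤ L := by linarith
  have hone' : 1 ≤ L₁ := by linarith
  -- The cube absorbs the exponent `3 * n + 1` of the Lipschitz bound.
  refine ⟨L₁ ^ 3, one_le_pow₀ hone', fun n hn w hw hw' => ?_⟩
  obtain ⟨m, rfl⟩ : ∃ m, n = m + 1 := ⟨n - 1, by omega⟩
  obtain ⟨ha, hb⟩ := h m none none w hw hw'
  have hrad : 1 / (L₁ ^ 3) ^ (m + 1) ≤ ρ / L ^ m := by
    rw [div_le_div_iff₀ (by positivity) (by positivity), ← pow_mul]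
    have : 1 ≤ ρ * L₁ := by
      rw [div_le_iff₀ hρ] at h2; linarith
    calc 1 * L ^ m ≤ (ρ * L₁) * L₁ ^ m := by gcongr
      _ = ρ * L₁ ^ (m + 1) := by ring
      _ ≤ ρ * L₁ ^ (3 * (m + 1)) := by
        have := pow_le_pow_right₀ hone' (show m + 1 ≤ 3 * (m + 1) by omega)
        gcongr
  have hpow : ∀ j, j ≤ 3 * (m + 1) → L ^ j ≤ (L₁ ^ 3) ^ (m + 1) := fun j hj => by
    rw [← pow_mul]
    calc L ^ j ≤ L₁ ^ j := by gcongr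
      _ ≤ _ := pow_le_pow_right₀ hone' hj
  exact ⟨(Metric.ball_subset_ball hrad).trans ha,
    hb.mono hrad (hpow _ (by omega)) (hpow _ (by omega))⟩

end Representatives

/-! ### Tangent vectors in coordinates -/

section TangentVectors

variable {M : Type*} [TopologicalSpace M] [ChartedSpace Plane M]
  {φ : OpenPartialHomeomorph M Plane}

lemma mdifferentiable_of_mem_maximalAtlas {r : WithTop ℕ∞} (hr : 1 ≤ r)
    (hφ : φ ∈ IsManifold.maximalAtlas (𝓡 2) r M) : φ.MDifferentiable (𝓡 2) (𝓡 2) :=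
  ⟨(contMDiffOn_of_mem_maximalAtlas hφ).mdifferentiableOn (by rintro rfl; simp at hr),
    (contMDiffOn_symm_of_mem_maximalAtlas hφ).mdifferentiableOn (by rintro rfl; simp at hr)⟩

lemma coordVector_eq_mfderiv_symm (hφ : φ.MDifferentiable (𝓡 2) (𝓡 2)) {x : M}
    (hx : x ∈ φ.source) (c : Plane) :
    coordVector φ x c = mfderiv (𝓡 2) (𝓡 2) φ.symm (φ x) c := by
  have h1 := hφ.symm_comp_deriv hx
  have h2 := hφ.comp_symm_deriv (φ.map_source hx)
  rw [φ.left_inv hx] at h2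
  have := ContinuousLinearMap.inverse_eq h2 h1
  rw [coordVector, this]
  rfl

lemma coordVector_injective (hφ : φ.MDifferentiable (𝓡 2) (𝓡 2)) {x : M}
    (hx : x ∈ φ.source) : Function.Injective (coordVector φ x) := by
  intro c c' h
  rw [coordVector_eq_mfderiv_symm hφ hx, coordVector_eq_mfderiv_symm hφ hx] at h
  exact hφ.symm.mfderiv_injective (φ.map_source hx) h

lemma mfderiv_coordVector (hφ : φ.MDifferentiable (𝓡 2) (𝓡 2)) {F : M → M}
    (hF : MDifferentiable (𝓡 2) (𝓡 2) F) {x : M} (hx : x ∈ φ.source) (hFx : F x ∈ φ.source)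
    {A : Plane →L[ℝ] Plane} (hA : HasFDerivAt (rep φ φ F) A (φ x)) (c : Plane) :
    mfderiv (𝓡 2) (𝓡 2) F x (coordVector φ x c) = coordVector φ (F x) (A c) := by
  obtain ⟨p, hp, rfl⟩ : ∃ p ∈ φ.target, φ.symm p = x := ⟨φ x, φ.map_source hx, φ.left_inv hx⟩
  rw [coordVector_eq_mfderiv_symm hφ hx, coordVector_eq_mfderiv_symm hφ hFx]
  rw [φ.right_inv hp] at hA ⊢
  have h3 := (hφ.mdifferentiableAt hFx).hasMFDerivAt.comp p
    ((hF (φ.symm p)).hasMFDerivAt.comp p (hφ.mdifferentiableAt_symm hp).hasMFDerivAt)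
  have h5 := hasMFDerivAt_unique h3 hA.hasMFDerivAt
  have h6 := DFunLike.congr_fun (hφ.symm_comp_deriv hFx)
    (mfderiv (𝓡 2) (𝓡 2) F (φ.symm p) (mfderiv (𝓡 2) (𝓡 2) φ.symm p c))
  have h7 := DFunLike.congr_fun h5 c
  exact h6.symm.trans (congrArg (mfderiv (𝓡 2) (𝓡 2) φ.symm (φ (F (φ.symm p)))) h7)

variable [IsManifold (𝓡 2) 1 M]

/-- On a compact set of a coordinate domain, the norm of a continuous Riemannian metric is
comparable with the Euclidean norm of the coordinates. -/
lemma exists_inner_coordVector_bounds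
    (g : Bundle.ContinuousRiemannianMetric Plane (fun x : M => TangentSpace (𝓡 2) x))
    {r : WithTop ℕ∞} (hr : 1 ≤ r) (hφ : φ ∈ IsManifold.maximalAtlas (𝓡 2) r M) {K : Set Plane}
    (hK : IsCompact K) (hKφ : K ⊆ φ.target) :
    ∃ c > 0, ∃ C > 0, ∀ p ∈ K, ∀ v : Plane,
      c * ‖v‖ ^ 2 ≤
        g.inner (φ.symm p) (coordVector φ (φ.symm p) v) (coordVector φ (φ.symm p) v) ∧
      g.inner (φ.symm p) (coordVector φ (φ.symm p) v) (coordVector φ (φ.symm p) v) ≤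
        C * ‖v‖ ^ 2 := by
  have hd := mdifferentiable_of_mem_maximalAtlas hr hφ
  set Ψ : Plane × Plane → ℝ := fun q => g.inner (φ.symm q.1)
    (mfderivWithin (𝓡 2) (𝓡 2) φ.symm φ.target q.1 q.2)
    (mfderivWithin (𝓡 2) (𝓡 2) φ.symm φ.target q.1 q.2) with hΨ
  have hΨeq : ∀ p ∈ φ.target, ∀ v, Ψ (p, v) =
      g.inner (φ.symm p) (coordVector φ (φ.symm p) v) (coordVector φ (φ.symm p) v) := by
    intro p hp v
    rw [coordVector_eq_mfderiv_symm hd (φ.map_target hp), φ.right_inv hp]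
    simp only [hΨ, mfderivWithin_of_isOpen φ.open_target hp]
  have hsec : ContinuousOn (fun q : Plane × Plane =>
      (Bundle.TotalSpace.mk' Plane (φ.symm q.1)
        (mfderivWithin (𝓡 2) (𝓡 2) φ.symm φ.target q.1 q.2 : TangentSpace (𝓡 2) (φ.symm q.1)) :
        TangentBundle (𝓡 2) M)) (φ.target ×ˢ univ) := by
    have h1 := ((contMDiffOn_symm_of_mem_maximalAtlas hφ).continuousOn_tangentMapWithin hr
      φ.open_target.uniqueMDiffOn)
    have h2 : Continuous (fun q : Plane × Plane =>
        ((tangentBundleModelSpaceHomeomorph (𝓡 2)).symm q : TangentBundle (𝓡 2) Plane)) :=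
      (tangentBundleModelSpaceHomeomorph (𝓡 2)).symm.continuous
    exact h1.comp h2.continuousOn (fun q hq => hq.1)
  have hcont : ContinuousOn Ψ (φ.target ×ˢ univ) := by
    have hg : ContinuousOn (fun q : Plane × Plane =>
        Bundle.TotalSpace.mk' (Plane →L[ℝ] Plane →L[ℝ] ℝ)
        (E := fun x : M => TangentSpace (𝓡 2) x →L[ℝ] TangentSpace (𝓡 2) x →L[ℝ] ℝ)
        (φ.symm q.1) (g.inner (φ.symm q.1))) (φ.target ×ˢ univ) :=
      g.continuous.comp_continuousOn
        (φ.continuousOn_symm.comp continuousOn_fst (fun q hq => hq.1))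
    have h3 := ContinuousOn.clm_bundle_apply₂ (F₃ := ℝ) (E₃ := Bundle.Trivial M ℝ)
      (b := fun q : Plane × Plane => φ.symm q.1) hg hsec hsec
    intro q hq
    have := h3 q hq
    rw [FiberBundle.continuousWithinAt_totalSpace] at this
    exact this.2
  have hS : IsCompact (K ×ˢ Metric.sphere (0 : Plane) 1) := hK.prod (isCompact_sphere _ _)
  have hcS : ContinuousOn Ψ (K ×ˢ Metric.sphere (0 : Plane) 1) :=
    hcont.mono (prod_mono hKφ (subset_univ _))
  have hpos : ∀ q ∈ K ×ˢ Metric.sphere (0 : Plane) 1, 0 < Ψ q := by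
    rintro ⟨p, v⟩ ⟨hp, hv⟩
    rw [hΨeq p (hKφ hp)]
    refine g.pos _ _ fun h0 => ?_
    have h00 : coordVector φ (φ.symm p) 0 = 0 :=
      ContinuousLinearMap.map_zero (mfderiv (𝓡 2) (𝓡 2) φ (φ.symm p)).inverse
    have : v = 0 := coordVector_injective hd (φ.map_target (hKφ hp)) (h0.trans h00.symm)
    simp [this] at hv
  obtain ⟨c, hc, hcle⟩ : ∃ c > 0, ∀ q ∈ K ×ˢ Metric.sphere (0 : Plane) 1, c ≤ Ψ q := by
    rcases (K ×ˢ Metric.sphere (0 : Plane) 1).eq_empty_or_nonempty with h | h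
    · exact ⟨1, one_pos, by simp [h]⟩
    · obtain ⟨q, hq, hmin⟩ := hS.exists_isMinOn h hcS
      exact ⟨Ψ q, hpos q hq, fun q' hq' => hmin hq'⟩
  obtain ⟨C, hC⟩ := hS.bddAbove_image hcS
  refine ⟨c, hc, max C 1, by positivity, fun p hp v => ?_⟩
  rw [← hΨeq p (hKφ hp)]
  have hhom : ∀ (t : ℝ) (w : Plane), Ψ (p, t • w) = t ^ 2 * Ψ (p, w) := by
    intro t w
    have hb : ∀ (x : M) (u : TangentSpace (𝓡 2) x),
        g.inner x (t • u) (t • u) = t ^ 2 * g.inner x u u := by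
      intro x u
      simp only [map_smul, _root_.smul_apply, smul_eq_mul]
      ring
    exact (congrArg (fun u : TangentSpace (𝓡 2) (φ.symm p) => g.inner (φ.symm p) u u)
      ((mfderivWithin (𝓡 2) (𝓡 2) φ.symm φ.target p).map_smul t w)).trans (hb _ _)
  rcases eq_or_ne v 0 with rfl | hv
  · have := hhom 0 0
    simp at this
    simp [this]
  · have hn : ‖v‖ ≠ 0 := norm_ne_zero_iff.2 hv
    have hmem : (p, (‖v‖⁻¹ • v)) ∈ K ×ˢ Metric.sphere (0 : Plane) 1 :=
      ⟨hp, by simp [norm_smul, hn]⟩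
    have hv' : Ψ (p, v) = Ψ (p, ‖v‖⁻¹ • v) * ‖v‖ ^ 2 := by
      rw [mul_comm, ← hhom, smul_smul, mul_inv_cancel₀ hn, one_smul]
    rw [hv']
    exact ⟨by gcongr; exact hcle _ hmem,
      by gcongr; exact (hC (mem_image_of_mem _ hmem)).trans (le_max_left _ _)⟩

end TangentVectors

section Composition

variable {M : Type*} [TopologicalSpace M]

lemma hasFDerivAt_rep_comp {φ : OpenPartialHomeomorph M Plane} {F G : M → M}
    (hF : Continuous F) {p : Plane} (hp : p ∈ repDomain φ φ F) {A B : Plane →L[ℝ] Plane}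
    (hA : HasFDerivAt (rep φ φ F) A p) (hB : HasFDerivAt (rep φ φ G) B (rep φ φ F p)) :
    HasFDerivAt (rep φ φ (G ∘ F)) (B.comp A) p := by
  refine (hB.comp p hA).congr_of_eventuallyEq ?_
  filter_upwards [(isOpen_repDomain φ φ hF).mem_nhds hp] with q hq
  simp only [Function.comp_apply]
  rw [rep, rep, symm_rep hq, Function.comp_apply]

lemma mem_repDomain_comp {φ : OpenPartialHomeomorph M Plane} {F G : M → M}
    {p : Plane} (hp : p ∈ repDomain φ φ F) (hp' : rep φ φ F p ∈ repDomain φ φ G) :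
    p ∈ repDomain φ φ (G ∘ F) := by
  refine ⟨hp.1, ?_⟩
  have := hp'.2
  simpa only [mem_preimage, symm_rep hp, Function.comp_apply] using this

lemma rep_comp_apply {φ : OpenPartialHomeomorph M Plane} {F G : M → M}
    {p : Plane} (hp : p ∈ repDomain φ φ F) :
    rep φ φ (G ∘ F) p = rep φ φ G (rep φ φ F p) := by
  simp only [rep, Function.comp_apply, φ.left_inv hp.2]

variable [ChartedSpace Plane M]

/-- The bounds of `exists_rep_iterate_bounds` for a diffeomorphism, together with the matching lower
bound for the derivative, which comes from the inverse diffeomorphism. -/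
lemma exists_rep_iterate_bounds_diffeomorph [CompactSpace M] [T2Space M] {r : WithTop ℕ∞}
    (hr : 2 ≤ r) [IsManifold (𝓡 2) r M] {φ : OpenPartialHomeomorph M Plane}
    (hφ : φ ∈ IsManifold.maximalAtlas (𝓡 2) r M) {K : Set M} (hK : IsCompact K)
    (hKφ : K ⊆ φ.source) (f : Diffeomorph (𝓡 2) (𝓡 2) M M r) :
    ∃ L : ℝ, 1 ≤ L ∧ ∀ n : ℕ, 1 ≤ n → ∀ w ∈ K, f^[n] w ∈ K →
      Metric.ball (φ w) (1 / L ^ n) ⊆ repDomain φ φ f^[n] ∧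
      BoundedDeriv (rep φ φ f^[n]) (φ w) (1 / L ^ n) (L ^ n) (L ^ n) ∧
      ∀ v, ‖v‖ ≤ L ^ n * ‖fderiv ℝ (rep φ φ f^[n]) (φ w) v‖ := by
  obtain ⟨L₁, hL₁, h₁⟩ := exists_rep_iterate_bounds hr hφ hK hKφ f.contMDiff
  obtain ⟨L₂, hL₂, h₂⟩ := exists_rep_iterate_bounds hr hφ hK hKφ f.symm.contMDiff
  refine ⟨max L₁ L₂, hL₁.trans (le_max_left _ _), fun n hn w hw hw' => ?_⟩
  have hle₁ : L₁ ^ n ≤ max L₁ L₂ ^ n := by gcongr; exact le_max_left _ _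
  have hle₂ : L₂ ^ n ≤ max L₁ L₂ ^ n := by gcongr; exact le_max_right _ _
  have hrad : 1 / max L₁ L₂ ^ n ≤ 1 / L₁ ^ n := by gcongr
  obtain ⟨ha, hb⟩ := h₁ n hn w hw hw'
  have hinv : Function.LeftInverse f.symm^[n] f^[n] :=
    Function.LeftInverse.iterate (fun x => f.symm_apply_apply x) n
  obtain ⟨ha', hb'⟩ := h₂ n hn (f^[n] w) hw' (by rwa [hinv w])
  refine ⟨(Metric.ball_subset_ball hrad).trans ha, hb.mono hrad hle₁ hle₁, fun v => ?_⟩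
  have hball : φ w ∈ Metric.ball (φ w) (1 / L₁ ^ n) := Metric.mem_ball_self (by positivity)
  have hball' : φ (f^[n] w) ∈ Metric.ball (φ (f^[n] w)) (1 / L₂ ^ n) :=
    Metric.mem_ball_self (by positivity)
  have hF : HasFDerivAt (rep φ φ f^[n]) (fderiv ℝ (rep φ φ f^[n]) (φ w)) (φ w) :=
    (hb.diff _ hball).hasFDerivAt
  have hG : HasFDerivAt (rep φ φ f.symm^[n]) (fderiv ℝ (rep φ φ f.symm^[n]) (φ (f^[n] w)))
      (φ (f^[n] w)) := (hb'.diff _ hball').hasFDerivAt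
  have hG' : HasFDerivAt (rep φ φ f.symm^[n]) (fderiv ℝ (rep φ φ f.symm^[n]) (φ (f^[n] w)))
      (rep φ φ f^[n] (φ w)) := by rwa [rep_apply _ _ (hKφ hw)]
  have hcomp := hasFDerivAt_rep_comp (f.continuous.iterate n) (ha hball) hF hG'
  have hid : HasFDerivAt (rep φ φ (f.symm^[n] ∘ f^[n])) (ContinuousLinearMap.id ℝ Plane) (φ w) := by
    refine (hasFDerivAt_id (φ w)).congr_of_eventuallyEq ?_
    filter_upwards [φ.open_target.mem_nhds (φ.map_source (hKφ hw))] with q hq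
    simp [rep, hinv (φ.symm q), φ.right_inv hq]
  have heq := DFunLike.congr_fun (hcomp.unique hid) v
  simp only [ContinuousLinearMap.comp_apply, ContinuousLinearMap.id_apply] at heq
  calc ‖v‖ = ‖fderiv ℝ (rep φ φ f.symm^[n]) (φ (f^[n] w))
        (fderiv ℝ (rep φ φ f^[n]) (φ w) v)‖ := by rw [heq]
    _ ≤ L₂ ^ n * ‖fderiv ℝ (rep φ φ f^[n]) (φ w) v‖ :=
      ContinuousLinearMap.le_of_opNorm_le _ (hb'.bound _ hball') _
    _ ≤ _ := by gcongr

end Composition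

/-! ### Iterates in the hyperbolic region -/

/-- The open box with centre `q`, half-width `a` and half-height `b`. -/
def box (q : Plane) (a b : ℝ) : Set Plane := {p | |p 0 - q 0| < a ∧ |p 1 - q 1| < b}

lemma isOpen_box (q : Plane) (a b : ℝ) : IsOpen (box q a b) :=
  (isOpen_lt (f := fun p : Plane => |p 0 - q 0|) (by fun_prop) continuous_const).inter
    (isOpen_lt (f := fun p : Plane => |p 1 - q 1|) (by fun_prop) continuous_const)

lemma mem_box_self (q : Plane) {a b : ℝ} (ha : 0 < a) (hb : 0 < b) : q ∈ box q a b := by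
  simp [box, ha, hb]

lemma convex_box (q : Plane) (a b : ℝ) : Convex ℝ (box q a b) := by
  intro x hx y hy s t hs ht hst
  have key : ∀ u v w c : ℝ, |u - w| < c → |v - w| < c → |s * u + t * v - w| < c := by
    intro u v w c hu hv
    have := (convex_ball w c) (x := u) (by simpa [Real.dist_eq] using hu) (y := v)
      (by simpa [Real.dist_eq] using hv) hs ht hst
    simpa [Real.dist_eq] using this
  exact ⟨by simpa using key _ _ _ _ hx.1 hy.1, by simpa using key _ _ _ _ hx.2 hy.2⟩

lemma norm_le_abs_add_abs (w : Plane) : ‖w‖ ≤ |w 0| + |w 1| := by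
  rw [EuclideanSpace.norm_eq, Fin.sum_univ_two]
  refine Real.sqrt_le_iff.2 ⟨by positivity, ?_⟩
  simp only [Real.norm_eq_abs]
  nlinarith [mul_nonneg (abs_nonneg (w 0)) (abs_nonneg (w 1))]

lemma abs_apply_le_norm (w : Plane) (i : Fin 2) : |w i| ≤ ‖w‖ := by
  simpa using PiLp.norm_apply_le w i

lemma box_subset_cthickening {S : Set Plane} {q : Plane} (hq : q ∈ S) {a b δ : ℝ}
    (ha : a ≤ δ) (hb : b ≤ δ) : box q a b ⊆ Metric.cthickening (2 * δ) S := by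
  intro p hp
  refine Metric.mem_cthickening_of_dist_le p q _ _ hq ?_
  rw [dist_eq_norm]
  have h1 := hp.1
  have h2 := hp.2
  have := norm_le_abs_add_abs (p - q)
  simp only [PiLp.sub_apply] at this
  linarith

/-- The diagonal linear map `(x, y) ↦ (s x, u y)`. -/
noncomputable def diagMap (s u : ℝ) : Plane →L[ℝ] Plane :=
  LinearMap.toContinuousLinearMap
    { toFun := fun p => !₂[s * p 0, u * p 1]
      map_add' := fun p q => by ext i; fin_cases i <;> simp [mul_add]
      map_smul' := fun c p => by ext i; fin_cases i <;> simp <;> ring }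

lemma diagMap_apply (s u : ℝ) (p : Plane) : diagMap s u p = !₂[s * p 0, u * p 1] := rfl

@[simp] lemma diagMap_apply_zero (s u : ℝ) (p : Plane) : diagMap s u p 0 = s * p 0 := by
  simp [diagMap_apply]

@[simp] lemma diagMap_apply_one (s u : ℝ) (p : Plane) : diagMap s u p 1 = u * p 1 := by
  simp [diagMap_apply]

lemma diagMap_comp (s u s' u' : ℝ) (p : Plane) :
    diagMap s u (diagMap s' u' p) = diagMap (s * s') (u * u') p := by
  ext i; fin_cases i <;> simp [mul_assoc]

lemma diagMap_mem_box {s u : ℝ} (hs : 0 < s) (hu : 0 < u) {p q : Plane} {a b : ℝ}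
    (hp : p ∈ box q a b) : diagMap s u p ∈ box (diagMap s u q) (s * a) (u * b) := by
  refine ⟨?_, ?_⟩
  · simp only [diagMap_apply_zero, ← mul_sub, abs_mul, abs_of_pos hs]
    exact mul_lt_mul_of_pos_left hp.1 hs
  · simp only [diagMap_apply_one, ← mul_sub, abs_mul, abs_of_pos hu]
    exact mul_lt_mul_of_pos_left hp.2 hu

section Hyperbolic

variable {M : Type*} [TopologicalSpace M]

/-- Suppose that `f` acts as the linear map `A` in the chart `φ` on those points of the chart domain
whose image lies there too. If `A` maps a connected open set `O` of coordinates into the range of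
the chart and `f` maps one point of `O` into the chart domain, then it does so for all of `O`. -/
lemma map_mem_source_of_isPreconnected [T2Space M] {f : M → M} (hf : Continuous f)
    {φ : OpenPartialHomeomorph M Plane} {A : Plane →L[ℝ] Plane}
    (hlin : ∀ z ∈ φ.source, f z ∈ φ.source → φ (f z) = A (φ z))
    {O : Set Plane} (hO : IsOpen O) (hOc : IsPreconnected O) (hOt : O ⊆ φ.target)
    (hA : ∀ p ∈ O, A p ∈ φ.target) {q : Plane} (hq : q ∈ O) (hq' : f (φ.symm q) ∈ φ.source)
    {p : Plane} (hp : p ∈ O) : f (φ.symm p) ∈ φ.source := by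
  have hc : ContinuousOn (fun p => f (φ.symm p)) O :=
    hf.comp_continuousOn (φ.continuousOn_symm.mono hOt)
  have hc' : ContinuousOn (fun p => φ.symm (A p)) O :=
    φ.continuousOn_symm.comp A.continuous.continuousOn hA
  set u : Set Plane := O ∩ (fun p => f (φ.symm p)) ⁻¹' φ.source with hu
  have huo : IsOpen u := hc.isOpen_inter_preimage hO φ.open_source
  have heq : ∀ p ∈ u, f (φ.symm p) = φ.symm (A p) := by
    rintro p ⟨hpO, hps⟩
    have := hlin _ (φ.map_target (hOt hpO)) hps
    rw [φ.right_inv (hOt hpO)] at this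
    rw [← this, φ.left_inv hps]
  have hsub : O ⊆ u := by
    refine hOc.subset_of_closure_inter_subset huo ⟨q, hq, hq, hq'⟩ ?_
    rintro p ⟨hpc, hpO⟩
    have hne : (𝓝[u] p).NeBot := mem_closure_iff_nhdsWithin_neBot.1 hpc
    have h1 : Tendsto (fun p => f (φ.symm p)) (𝓝[u] p) (𝓝 (f (φ.symm p))) :=
      (hc p hpO).mono_left (nhdsWithin_mono p inter_subset_left)
    have h2 : Tendsto (fun p => φ.symm (A p)) (𝓝[u] p) (𝓝 (φ.symm (A p))) :=
      (hc' p hpO).mono_left (nhdsWithin_mono p inter_subset_left)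
    have h3 : f (φ.symm p) = φ.symm (A p) := by
      refine tendsto_nhds_unique (h1.congr' ?_) h2
      filter_upwards [self_mem_nhdsWithin] with z hz using heq z hz
    refine ⟨hpO, ?_⟩
    change f (φ.symm p) ∈ φ.source
    rw [h3]
    exact φ.map_target (hA p hpO)
  exact (hsub hp).2

/-- Around an orbit segment of length `N` in `K`, the iterates up to `N` are linear on a box whose
image under the `N`-th iterate has size at most `δ`. -/
lemma iterate_eq_diagMap [T2Space M] {f : M → M} (hf : Continuous f)
    {φ : OpenPartialHomeomorph M Plane} {lamS lamU : ℝ} (hs : 0 < lamS) (hs' : lamS ≤ 1)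
    (hu : 1 ≤ lamU)
    (hlin : ∀ z ∈ φ.source, f z ∈ φ.source → φ (f z) = diagMap lamS lamU (φ z))
    {K : Set M} (hK : K ⊆ φ.source) {δ : ℝ}
    (hδ : Metric.cthickening (2 * δ) (φ '' K) ⊆ φ.target) {ζ : M} {N : ℕ}
    (hstay : ∀ j ≤ N, f^[j] ζ ∈ K) {a b : ℝ} (ha : 0 < a) (hb : 0 < b) (haδ : a ≤ δ)
    (hbδ : lamU ^ N * b ≤ δ) {p : Plane} (hp : p ∈ box (φ ζ) a b) {j : ℕ} (hj : j ≤ N) :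
    p ∈ repDomain φ φ f^[j] ∧ rep φ φ f^[j] p = diagMap (lamS ^ j) (lamU ^ j) p := by
  have hu0 : 0 < lamU := by linarith
  have hbox : ∀ i ≤ N, box (φ (f^[i] ζ)) (lamS ^ i * a) (lamU ^ i * b) ⊆ φ.target := by
    intro i hi
    refine (box_subset_cthickening (mem_image_of_mem φ (hstay i hi)) ?_ ?_).trans hδ
    · exact (mul_le_of_le_one_left ha.le (pow_le_one₀ hs.le hs')).trans haδ
    · exact le_trans (by gcongr) hbδ
  have hcent : ∀ i < N, φ (f^[i + 1] ζ) = diagMap lamS lamU (φ (f^[i] ζ)) := by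
    intro i hi
    rw [Function.iterate_succ_apply']
    refine hlin _ (hK (hstay i hi.le)) ?_
    rw [← Function.iterate_succ_apply' f i ζ]
    exact hK (hstay (i + 1) hi)
  have hmove : ∀ i < N, ∀ z ∈ box (φ (f^[i] ζ)) (lamS ^ i * a) (lamU ^ i * b),
      diagMap lamS lamU z ∈ box (φ (f^[i + 1] ζ)) (lamS ^ (i + 1) * a) (lamU ^ (i + 1) * b) := by
    intro i hi z hz
    have := diagMap_mem_box hs hu0 hz
    rw [hcent i hi]
    rwa [pow_succ', pow_succ', mul_assoc, mul_assoc]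
  have main : ∀ j ≤ N, p ∈ repDomain φ φ f^[j] ∧
      rep φ φ f^[j] p = diagMap (lamS ^ j) (lamU ^ j) p ∧
      rep φ φ f^[j] p ∈ box (φ (f^[j] ζ)) (lamS ^ j * a) (lamU ^ j * b) := by
    intro j
    induction j with
    | zero =>
      intro _
      have hpt : p ∈ φ.target := by simpa using hbox 0 (Nat.zero_le _) (by simpa using hp)
      have hrep : rep φ φ f^[0] p = p := by simp [rep, φ.right_inv hpt]
      refine ⟨⟨hpt, by simpa using φ.map_target hpt⟩, ?_, ?_⟩
      · rw [hrep]; ext i; fin_cases i <;> simp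
      · rw [hrep]; simpa using hp
    | succ i ih =>
      intro hi
      obtain ⟨h1, h2, h3⟩ := ih (by omega)
      have hi' : i < N := hi
      have h4 : f (φ.symm (rep φ φ f^[i] p)) ∈ φ.source := by
        refine map_mem_source_of_isPreconnected hf hlin (isOpen_box _ _ _)
          (convex_box _ _ _).isPreconnected (hbox i hi'.le)
          (fun z hz => hbox (i + 1) hi (hmove i hi' z hz))
          (mem_box_self (φ (f^[i] ζ)) (by positivity) (by positivity)) ?_ h3
        rw [φ.left_inv (hK (hstay i hi'.le)), ← Function.iterate_succ_apply' f i ζ]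
        exact hK (hstay (i + 1) hi)
      have h5 : rep φ φ f^[i + 1] p = diagMap lamS lamU (rep φ φ f^[i] p) := by
        have := hlin _ h1.2 (by rwa [symm_rep h1] at h4)
        rw [rep, Function.iterate_succ_apply', this]
        rfl
      refine ⟨⟨h1.1, ?_⟩, ?_, ?_⟩
      · rw [symm_rep h1] at h4
        simpa only [mem_preimage, Function.iterate_succ_apply'] using h4
      · rw [h5, h2, diagMap_comp, pow_succ', pow_succ']
      · rw [h5]; exact hmove i hi' _ h3
  exact ⟨(main j hj).1, (main j hj).2.1⟩

end Hyperbolic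

/-! ### One return -/

@[simp] lemma vS_zero : vS 0 = 1 := by simp [vS]
@[simp] lemma vS_one : vS 1 = 0 := by simp [vS]
@[simp] lemma vU_zero : vU 0 = 0 := by simp [vU]
@[simp] lemma vU_one : vU 1 = 1 := by simp [vU]

lemma norm_vS : ‖vS‖ = 1 := by simp [EuclideanSpace.norm_eq, Fin.sum_univ_two]
lemma norm_vU : ‖vU‖ = 1 := by simp [EuclideanSpace.norm_eq, Fin.sum_univ_two]

lemma eq_smul_vS_add_smul_vU (w : Plane) : w = w 0 • vS + w 1 • vU := by
  ext i; fin_cases i <;> simp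

lemma map_apply_eq (A : Plane →L[ℝ] Plane) (w : Plane) (i : Fin 2) :
    A w i = w 0 * A vS i + w 1 * A vU i := by
  conv_lhs => rw [eq_smul_vS_add_smul_vU w]
  simp

/-- `A`, of norm at most `Q`, nearly exchanges the two coordinate axes: the off-diagonal entries of
its matrix are at least `1 / (2 * Q)` in absolute value, and the entry which keeps vertical vectors
vertical is at most `Q * d`. The remaining entry is only bounded by `Q`. -/
structure NearlyTurns (A : Plane →L[ℝ] Plane) (Q d : ℝ) : Prop where
  norm_le : ‖A‖ ≤ Q
  vertical_one : |A vU 1| ≤ Q * d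
  vertical_zero : 1 / (2 * Q) ≤ |A vU 0|
  horizontal_one : 1 / (2 * Q) ≤ |A vS 1|

lemma NearlyTurns.abs_apply_le {A : Plane →L[ℝ] Plane} {Q d : ℝ} (h : NearlyTurns A Q d)
    (i : Fin 2) : |A vS i| ≤ Q ∧ |A vU i| ≤ Q := by
  constructor
  · calc |A vS i| ≤ ‖A vS‖ := abs_apply_le_norm _ _
      _ ≤ Q * ‖vS‖ := A.le_of_opNorm_le h.norm_le _
      _ = Q := by rw [norm_vS, mul_one]
  · calc |A vU i| ≤ ‖A vU‖ := abs_apply_le_norm _ _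
      _ ≤ Q * ‖vU‖ := A.le_of_opNorm_le h.norm_le _
      _ = Q := by rw [norm_vU, mul_one]

/-- A map which is close in norm to an exact turn `A₀` nearly turns. -/
lemma nearlyTurns_of_norm_sub_le {A A₀ : Plane →L[ℝ] Plane} {Q d c : ℝ} (hQ : 1 ≤ Q)
    (hA : ‖A‖ ≤ Q) (htan : A₀ vU = c • vS) (hlow : ∀ v, ‖v‖ ≤ Q * ‖A₀ v‖)
    (hsub : ‖A - A₀‖ ≤ Q * d) (hd : 2 * Q ^ 2 * d ≤ 1) : NearlyTurns A Q d := by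
  have hQ0 : 0 < Q := by linarith
  have hdiff : ∀ v : Plane, ‖v‖ = 1 → ∀ i, |A v i - A₀ v i| ≤ Q * d := by
    intro v hv i
    calc |A v i - A₀ v i| = |((A - A₀) v) i| := by simp
      _ ≤ ‖(A - A₀) v‖ := abs_apply_le_norm _ _
      _ ≤ Q * d * ‖v‖ := ContinuousLinearMap.le_of_opNorm_le _ hsub _
      _ = Q * d := by rw [hv, mul_one]
  have hdle : Q * d ≤ 1 / (2 * Q) := by
    rw [le_div_iff₀ (by positivity)]; nlinarith
  have hhalf : 1 / Q = 1 / (2 * Q) + 1 / (2 * Q) := by field_simp; norm_num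
  have hU0 : 1 / Q ≤ |A₀ vU 0| := by
    have h := hlow vU
    rw [htan, norm_smul, norm_vU, norm_vS, mul_one, Real.norm_eq_abs] at h
    rw [htan, div_le_iff₀ hQ0]
    simpa [mul_comm] using h
  have hS1 : 1 / Q ≤ |A₀ vS 1| := by
    -- A preimage `w` of `vU` has norm at most `Q`, and only `w 0 * A₀ vS 1` contributes to `vU 1`.
    have hinj : Function.Injective (A₀ : Plane →ₗ[ℝ] Plane) := by
      rw [injective_iff_map_eq_zero]
      intro v hv
      have h := hlow v
      have hv' : A₀ v = 0 := hv
      rw [hv', norm_zero, mul_zero] at h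
      exact norm_le_zero_iff.1 h
    obtain ⟨w, hw⟩ := LinearMap.injective_iff_surjective.1 hinj vU
    have hw' : A₀ w = vU := hw
    have h1 := hlow w
    rw [hw', norm_vU, mul_one] at h1
    have h2 := map_apply_eq A₀ w 1
    rw [hw', htan] at h2
    simp only [vU_one, PiLp.smul_apply, vS_one, smul_zero, mul_zero, add_zero] at h2
    have h3 := (abs_apply_le_norm w 0).trans h1
    rw [div_le_iff₀ hQ0]
    calc (1 : ℝ) = |w 0| * |A₀ vS 1| := by rw [← abs_mul, ← h2, abs_one]
      _ ≤ Q * |A₀ vS 1| := by gcongr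
      _ = _ := mul_comm _ _
  refine ⟨hA, ?_, ?_, ?_⟩
  · simpa [htan] using hdiff vU norm_vU 1
  · have h1 := hdiff vU norm_vU 0
    have h2 := abs_sub_abs_le_abs_sub (A₀ vU 0) (A vU 0)
    rw [abs_sub_comm] at h2
    linarith
  · have h1 := hdiff vS norm_vS 1
    have h2 := abs_sub_abs_le_abs_sub (A₀ vS 1) (A vS 1)
    rw [abs_sub_comm] at h2
    linarith

/-- The image of a box of half-width `a` and half-height `b`, with `a + b ≤ d`, under a map with a
tangency at the centre: the half-height `b` contributes to the vertical size of the image only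
through the second order term `d ^ 2`. -/
lemma BoundedDeriv.mem_box_of_tangent {T : Plane → Plane} {w : Plane} {Q a b a' b' d c : ℝ}
    (hQ : 1 ≤ Q) (hT : BoundedDeriv T w (1 / Q) Q Q) (htan : fderiv ℝ T w vU = c • vS)
    (hab : a + b ≤ d) (hdQ : d < 1 / Q) (ha' : Q * d < a') (hb' : Q * a + Q * d ^ 2 < b')
    {p : Plane} (hp : p ∈ box w a b) :
    p ∈ Metric.ball w (1 / Q) ∧ ‖p - w‖ ≤ d ∧ T p ∈ box (T w) a' b' := by
  have hQ0 : 0 < Q := by linarith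
  have hnorm : ‖p - w‖ ≤ d := by
    have h := norm_le_abs_add_abs (p - w)
    have h1 := hp.1
    have h2 := hp.2
    simp only [PiLp.sub_apply] at h
    linarith
  have hball : p ∈ Metric.ball w (1 / Q) := by
    rw [Metric.mem_ball, dist_eq_norm]; linarith
  have hw : w ∈ Metric.ball w (1 / Q) := Metric.mem_ball_self (by positivity)
  refine ⟨hball, hnorm, ?_, ?_⟩
  · calc |T p 0 - T w 0| = |(T p - T w) 0| := by simp
      _ ≤ ‖T p - T w‖ := abs_apply_le_norm _ _
      _ ≤ Q * ‖p - w‖ := hT.norm_sub_le hball hw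
      _ ≤ Q * d := by gcongr
      _ < a' := ha'
  · have h1 := hT.norm_sub_sub_le hQ0.le hball
    have h2 : fderiv ℝ T w (p - w) 1 = (p 0 - w 0) * fderiv ℝ T w vS 1 := by
      rw [map_apply_eq, htan]; simp
    have h3 : |fderiv ℝ T w vS 1| ≤ Q := by
      calc _ ≤ ‖fderiv ℝ T w vS‖ := abs_apply_le_norm _ _
        _ ≤ Q * ‖vS‖ := ContinuousLinearMap.le_of_opNorm_le _ (hT.bound w hw) _
        _ = Q := by rw [norm_vS, mul_one]
    have h4 : |(p 0 - w 0) * fderiv ℝ T w vS 1| ≤ a * Q := by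
      rw [abs_mul]
      exact mul_le_mul hp.1.le h3 (abs_nonneg _) ((abs_nonneg _).trans hp.1.le)
    have h5 := (abs_apply_le_norm (T p - T w - fderiv ℝ T w (p - w)) 1).trans h1
    simp only [PiLp.sub_apply] at h5
    rw [h2] at h5
    have h6 : Q * ‖p - w‖ ^ 2 ≤ Q * d ^ 2 := by gcongr
    calc |T p 1 - T w 1|
        = |(T p 1 - T w 1 - (p 0 - w 0) * fderiv ℝ T w vS 1) +
            (p 0 - w 0) * fderiv ℝ T w vS 1| := by rw [sub_add_cancel]
      _ ≤ Q * d ^ 2 + a * Q := (abs_add_le _ _).trans (add_le_add (h5.trans h6) h4)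
      _ < b' := by linarith

section Return

variable {M : Type*} [TopologicalSpace M]

/-- One return: a box about `φ ζ` is mapped by `f^[n + N]` into a box about the coordinates of
`f^[n + N] ζ`, and the derivative is a diagonal map followed by a map which nearly turns. -/
lemma exists_return_hasFDerivAt [T2Space M] {f : M → M} (hf : Continuous f)
    {φ : OpenPartialHomeomorph M Plane} {lamS lamU : ℝ} (hs : 0 < lamS) (hs' : lamS ≤ 1)
    (hu : 1 ≤ lamU)
    (hlin : ∀ z ∈ φ.source, f z ∈ φ.source → φ (f z) = diagMap lamS lamU (φ z))
    {K : Set M} (hK : K ⊆ φ.source) {δ : ℝ}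
    (hδ : Metric.cthickening (2 * δ) (φ '' K) ⊆ φ.target) {ζ : M} {N n : ℕ}
    (hstay : ∀ j ≤ N, f^[j] ζ ∈ K) {Q a b a' b' d c : ℝ} (hQ : 1 ≤ Q)
    (hdom : Metric.ball (φ (f^[N] ζ)) (1 / Q) ⊆ repDomain φ φ f^[n])
    (hT : BoundedDeriv (rep φ φ f^[n]) (φ (f^[N] ζ)) (1 / Q) Q Q)
    (hlow : ∀ v, ‖v‖ ≤ Q * ‖fderiv ℝ (rep φ φ f^[n]) (φ (f^[N] ζ)) v‖)
    (htan : fderiv ℝ (rep φ φ f^[n]) (φ (f^[N] ζ)) vU = c • vS)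
    (ha : 0 < a) (hb : 0 < b) (haδ : a ≤ δ) (hbδ : lamU ^ N * b ≤ δ)
    (hd : lamS ^ N * a + lamU ^ N * b ≤ d) (hdQ : 2 * Q ^ 2 * d ≤ 1) (ha' : Q * d < a')
    (hb' : Q * (lamS ^ N * a) + Q * d ^ 2 < b') {p : Plane} (hp : p ∈ box (φ ζ) a b) :
    p ∈ repDomain φ φ f^[N] ∧
    HasFDerivAt (rep φ φ f^[N]) (diagMap (lamS ^ N) (lamU ^ N)) p ∧
    rep φ φ f^[N] p ∈ box (φ (f^[N] ζ)) δ δ ∧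
    p ∈ repDomain φ φ f^[n + N] ∧
    rep φ φ f^[n + N] p ∈ box (φ (f^[n + N] ζ)) a' b' ∧
    ∃ A, NearlyTurns A Q d ∧
      HasFDerivAt (rep φ φ f^[n + N]) (A.comp (diagMap (lamS ^ N) (lamU ^ N))) p := by
  have hu0 : 0 < lamU := by linarith
  have hQ0 : 0 < Q := by linarith
  have hlinear : ∀ z ∈ box (φ ζ) a b, z ∈ repDomain φ φ f^[N] ∧
      rep φ φ f^[N] z = diagMap (lamS ^ N) (lamU ^ N) z := fun z hz =>
    iterate_eq_diagMap hf hs hs' hu hlin hK hδ hstay ha hb haδ hbδ hz le_rfl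
  obtain ⟨hp1, hp2⟩ := hlinear p hp
  have hder : HasFDerivAt (rep φ φ f^[N]) (diagMap (lamS ^ N) (lamU ^ N)) p := by
    refine (diagMap (lamS ^ N) (lamU ^ N)).hasFDerivAt.congr_of_eventuallyEq ?_
    filter_upwards [(isOpen_box _ _ _).mem_nhds hp] with z hz using (hlinear z hz).2
  have hζ : ζ ∈ φ.source := hK (hstay 0 (Nat.zero_le _))
  have hcent : φ (f^[N] ζ) = diagMap (lamS ^ N) (lamU ^ N) (φ ζ) := by
    rw [← (hlinear _ (mem_box_self _ ha hb)).2, rep_apply _ _ hζ]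
  have hbox : rep φ φ f^[N] p ∈ box (φ (f^[N] ζ)) (lamS ^ N * a) (lamU ^ N * b) := by
    rw [hp2, hcent]
    exact diagMap_mem_box (by positivity) (by positivity) hp
  have hd0 : 0 < d := lt_of_lt_of_le (by positivity) hd
  have hdQ' : d < 1 / Q := by
    rw [lt_div_iff₀ hQ0]
    have h1 : 0 < d * Q := by positivity
    nlinarith [mul_le_mul_of_nonneg_right hQ h1.le]
  obtain ⟨hball, hnorm, hmem⟩ := hT.mem_box_of_tangent hQ htan hd hdQ' ha' hb' hbox
  have hp3 : rep φ φ f^[N] p ∈ repDomain φ φ f^[n] := hdom hball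
  have hit : f^[n + N] = f^[n] ∘ f^[N] := Function.iterate_add f n N
  have hw : φ (f^[N] ζ) ∈ Metric.ball (φ (f^[N] ζ)) (1 / Q) :=
    Metric.mem_ball_self (by positivity)
  have hNa : lamS ^ N * a ≤ δ := (mul_le_of_le_one_left ha.le (pow_le_one₀ hs.le hs')).trans haδ
  refine ⟨hp1, hder, ⟨hbox.1.trans_le hNa, hbox.2.trans_le hbδ⟩, ?_, ?_, fderiv ℝ (rep φ φ f^[n]) (rep φ φ f^[N] p), ?_, ?_⟩
  · rw [hit]; exact mem_repDomain_comp hp1 hp3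
  · rw [hit, rep_comp_apply hp1, Function.comp_apply, ← rep_apply φ f^[n] (hK (hstay N le_rfl))]
    exact hmem
  · refine nearlyTurns_of_norm_sub_le hQ (hT.bound _ hball) htan hlow ?_ hdQ
    exact (hT.lip _ hball _ hw).trans (by gcongr)
  · rw [hit]
    exact hasFDerivAt_rep_comp (hf.iterate N) hp1 hder (hT.diff _ hball).hasFDerivAt

end Return

/-! ### Tangent vectors over two returns -/

section TwoReturns

variable {A A' : Plane →L[ℝ] Plane} {Q Q' S T S' T' : ℝ}

/-- Over two returns the vertical component of a steep vector is first expanded by `T` and turned to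
the horizontal, then contracted by `S'` and turned back. -/
lemma abs_vertical_two_returns_ge (hQ : 0 < Q) (hQ' : 0 < Q') (hS : 0 < S) (hT : 0 < T)
    (hS' : 0 < S') (hT' : 0 < T') (hA : NearlyTurns A Q (2 * (S / T)))
    (hA' : NearlyTurns A' Q' (2 * (S' / T'))) {r : ℝ} (hr : 1 ≤ r)
    (hsmall : 56 * Q ^ 2 * Q' ^ 2 * (S / T) * r ≤ 1) {v : Plane} (hv : |v 0| ≤ r * |v 1|) :
    1 / (8 * Q * Q') * (S' * T) * |v 1| ≤
      |A' (diagMap S' T' (A (diagMap S T v))) 1| := by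
  set x := A (diagMap S T v) with hx
  have hx0 : x 0 = S * v 0 * A vS 0 + T * v 1 * A vU 0 := by rw [hx, map_apply_eq]; simp
  have hx1 : x 1 = S * v 0 * A vS 1 + T * v 1 * A vU 1 := by rw [hx, map_apply_eq]; simp
  have hy : A' (diagMap S' T' x) 1 = S' * x 0 * A' vS 1 + T' * x 1 * A' vU 1 := by
    rw [map_apply_eq]; simp
  -- The left-hand side is the contribution which dominates the new vertical component.
  have e : S' * (T * v 1 * A vU 0) * A' vS 1 = A' (diagMap S' T' x) 1
      - S' * (S * v 0 * A vS 0) * A' vS 1 - T' * (S * v 0 * A vS 1) * A' vU 1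
      - T' * (T * v 1 * A vU 1) * A' vU 1 := by
    rw [hy, hx0, hx1]; ring
  have hTd : T * (2 * (S / T)) = 2 * S := by field_simp
  have hTd' : T' * (2 * (S' / T')) = 2 * S' := by field_simp
  have h1 : |S' * (S * v 0 * A vS 0) * A' vS 1| ≤ S' * (S * (r * |v 1|) * Q) * Q' := by
    simp only [abs_mul, abs_of_pos hS, abs_of_pos hS']
    gcongr
    · exact (hA.abs_apply_le 0).1
    · exact (hA'.abs_apply_le 1).1
  have h2 : |T' * (S * v 0 * A vS 1) * A' vU 1| ≤
      T' * (S * (r * |v 1|) * Q) * (Q' * (2 * (S' / T'))) := by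
    simp only [abs_mul, abs_of_pos hS, abs_of_pos hT']
    gcongr
    · exact (hA.abs_apply_le 1).1
    · exact hA'.vertical_one
  have h3 : |T' * (T * v 1 * A vU 1) * A' vU 1| ≤
      T' * (T * (r * |v 1|) * (Q * (2 * (S / T)))) * (Q' * (2 * (S' / T'))) := by
    simp only [abs_mul, abs_of_pos hT, abs_of_pos hT']
    gcongr
    · exact le_mul_of_one_le_left (abs_nonneg _) hr
    · exact hA.vertical_one
    · exact hA'.vertical_one
  have h4 : S' * (T * |v 1| * (1 / (2 * Q))) * (1 / (2 * Q')) ≤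
      |S' * (T * v 1 * A vU 0) * A' vS 1| := by
    simp only [abs_mul, abs_of_pos hT, abs_of_pos hS']
    gcongr
    · exact hA.vertical_zero
    · exact hA'.horizontal_one
  have h5 : |S' * (T * v 1 * A vU 0) * A' vS 1| ≤ |A' (diagMap S' T' x) 1| +
      S' * (S * (r * |v 1|) * Q) * Q' + T' * (S * (r * |v 1|) * Q) * (Q' * (2 * (S' / T'))) +
      T' * (T * (r * |v 1|) * (Q * (2 * (S / T)))) * (Q' * (2 * (S' / T'))) := by
    rw [e]
    refine (abs_sub _ _).trans (add_le_add ((abs_sub _ _).trans (add_le_add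
      ((abs_sub _ _).trans (add_le_add le_rfl h1)) h2)) h3)
  have h6 : T' * (S * (r * |v 1|) * Q) * (Q' * (2 * (S' / T'))) =
      2 * (S' * S * r * |v 1| * Q * Q') := by
    calc _ = (S * (r * |v 1|) * Q) * Q' * (T' * (2 * (S' / T'))) := by ring
      _ = _ := by rw [hTd']; ring
  have h7 : T' * (T * (r * |v 1|) * (Q * (2 * (S / T)))) * (Q' * (2 * (S' / T'))) =
      4 * (S' * S * r * |v 1| * Q * Q') := by
    calc _ = (r * |v 1|) * Q * Q' * (T * (2 * (S / T))) * (T' * (2 * (S' / T'))) := by ring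
      _ = _ := by rw [hTd, hTd']; ring
  have h8 : 7 * (S' * S * r * |v 1| * Q * Q') ≤ 1 / (8 * Q * Q') * (S' * T) * |v 1| := by
    have : 7 * (S' * S * r * |v 1| * Q * Q') =
        1 / (8 * Q * Q') * (S' * T) * |v 1| * (56 * Q ^ 2 * Q' ^ 2 * (S / T) * r) := by
      field_simp; ring
    rw [this]
    exact mul_le_of_le_one_right (by positivity) hsmall
  have h9 : S' * (T * |v 1| * (1 / (2 * Q))) * (1 / (2 * Q')) =
      2 * (1 / (8 * Q * Q') * (S' * T) * |v 1|) := by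
    field_simp; ring
  rw [h6, h7] at h5
  rw [h9] at h4
  linarith

/-- Over two returns nothing grows faster than by contraction by `S` and expansion by `T'`: vertical
vectors which are not turned by `A` carry a factor `S / T`, which compensates their expansion. -/
lemma abs_two_returns_le (hS : 0 < S) (hT : 0 < T)
    (hS' : 0 < S') (hT' : 0 < T') (hST' : S' ≤ T') (hmono : S' * T ≤ T' * S)
    (hA : NearlyTurns A Q (2 * (S / T))) (hA' : NearlyTurns A' Q' (2 * (S' / T')))
    {m : ℝ} {v : Plane} (hv0 : |v 0| ≤ m) (hv1 : |v 1| ≤ m) (i : Fin 2) :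
    |A' (diagMap S' T' (A (diagMap S T v))) i| ≤ 5 * Q * Q' * (T' * S) * m := by
  have hm : 0 ≤ m := (abs_nonneg _).trans hv0
  have hQ : 0 ≤ Q := (norm_nonneg _).trans hA.norm_le
  have hQ' : 0 ≤ Q' := (norm_nonneg _).trans hA'.norm_le
  set x := A (diagMap S T v) with hx
  have hx0 : x 0 = S * v 0 * A vS 0 + T * v 1 * A vU 0 := by rw [hx, map_apply_eq]; simp
  have hx1 : x 1 = S * v 0 * A vS 1 + T * v 1 * A vU 1 := by rw [hx, map_apply_eq]; simp
  have hTd : T * (2 * (S / T)) = 2 * S := by field_simp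
  have h0 : |x 0| ≤ S * m * Q + T * m * Q := by
    rw [hx0]
    refine (abs_add_le _ _).trans ?_
    simp only [abs_mul, abs_of_pos hS, abs_of_pos hT]
    gcongr
    · exact (hA.abs_apply_le 0).1
    · exact (hA.abs_apply_le 0).2
  have h1 : |x 1| ≤ 3 * S * m * Q := by
    rw [hx1]
    refine (abs_add_le _ _).trans ?_
    simp only [abs_mul, abs_of_pos hS, abs_of_pos hT]
    calc _ ≤ S * m * Q + T * m * (Q * (2 * (S / T))) := by
          gcongr
          · exact (hA.abs_apply_le 1).1
          · exact hA.vertical_one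
      _ = S * m * Q + m * Q * (T * (2 * (S / T))) := by ring
      _ = _ := by rw [hTd]; ring
  have hy : A' (diagMap S' T' x) i = S' * x 0 * A' vS i + T' * x 1 * A' vU i := by
    rw [map_apply_eq]; simp
  rw [hy]
  refine (abs_add_le _ _).trans ?_
  simp only [abs_mul, abs_of_pos hS', abs_of_pos hT']
  calc _ ≤ S' * (S * m * Q + T * m * Q) * Q' + T' * (3 * S * m * Q) * Q' := by
        gcongr
        · exact (hA'.abs_apply_le i).1
        · exact (hA'.abs_apply_le i).2
    _ = (S' * S + S' * T) * (m * Q * Q') + 3 * (T' * S) * (m * Q * Q') := by ring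
    _ ≤ (T' * S + T' * S) * (m * Q * Q') + 3 * (T' * S) * (m * Q * Q') := by gcongr
    _ = _ := by ring

end TwoReturns

/-! ### Averages along subsequences -/

/-- If the increments of `z` are eventually at least `q` times those of `θ → ∞`, then
`z / θ ≥ q - ε` in the limit, whatever constant is added to `z`. -/
lemma eventually_sub_le_div {z θ : ℕ → ℝ} {q : ℝ} (hθ : Tendsto θ atTop atTop)
    (h : ∀ᶠ i in atTop, q * (θ (i + 1) - θ i) ≤ z (i + 1) - z i) (C : ℝ) {ε : ℝ} (hε : 0 < ε) :
    ∀ᶠ i in atTop, q - ε ≤ (z i + C) / θ i := by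
  obtain ⟨i₀, hi₀⟩ := eventually_atTop.1 h
  have hmono : ∀ i ≥ i₀, z i₀ - q * θ i₀ ≤ z i - q * θ i := by
    intro i hi
    induction i, hi using Nat.le_induction with
    | base => exact le_rfl
    | succ i hi ih => have := hi₀ i hi; linarith
  filter_upwards [eventually_ge_atTop i₀, hθ.eventually_gt_atTop 0,
    hθ.eventually_ge_atTop (-(z i₀ - q * θ i₀ + C) / ε)] with i hi hpos hbig
  rw [le_div_iff₀ hpos]
  rw [div_le_iff₀ hε] at hbig
  have := hmono i hi
  linarith

lemma eventually_div_le_add {z θ : ℕ → ℝ} {q : ℝ} (hθ : Tendsto θ atTop atTop)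
    (h : ∀ᶠ i in atTop, z (i + 1) - z i ≤ q * (θ (i + 1) - θ i)) (C : ℝ) {ε : ℝ} (hε : 0 < ε) :
    ∀ᶠ i in atTop, (z i + C) / θ i ≤ q + ε := by
  have := eventually_sub_le_div (z := fun i => -z i) (q := -q) hθ
    (h.mono fun i hi => by linarith) (-C) hε
  filter_upwards [this] with i hi
  have e : (-z i + -C) / θ i = -((z i + C) / θ i) := by rw [← neg_add, neg_div]
  rw [e] at hi
  linarith

lemma liminf_coe_le_of_frequently {u : ℕ → ℝ} {q : ℝ}
    (h : ∀ ε > 0, ∃ᶠ n in atTop, u n ≤ q + ε) :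
    liminf (fun n => (u n : EReal)) atTop ≤ q := by
  refine EReal.le_of_forall_lt_iff_le.1 fun z hz => ?_
  refine liminf_le_of_frequently_le' ((h (z - q) (by simpa using hz)).mono fun n hn => ?_)
  exact_mod_cast (by linarith : u n ≤ z)

lemma le_limsup_coe_of_frequently {u : ℕ → ℝ} {q : ℝ}
    (h : ∀ ε > 0, ∃ᶠ n in atTop, q - ε ≤ u n) :
    (q : EReal) ≤ limsup (fun n => (u n : EReal)) atTop := by
  refine EReal.ge_of_forall_gt_iff_ge.1 fun z hz => ?_
  refine le_limsup_of_frequently_le' ((h (q - z) (by simpa using hz)).mono fun n hn => ?_)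
  exact_mod_cast (by linarith : z ≤ u n)

/-! ### Asymptotics of the return times -/

lemma eventually_le_mul_of_tendsto_ratio {nH nT : ℕ → ℕ} (hH : Tendsto nH atTop atTop)
    (h : Tendsto (fun k => (nH k : ℝ) / ((nH k + nT k : ℕ) : ℝ)) atTop (𝓝 1)) {ε : ℝ}
    (hε : 0 < ε) : ∀ᶠ k in atTop, (nT k : ℝ) ≤ ε * nH k := by
  have h1 : (1 : ℝ) / (1 + ε) < 1 := by rw [div_lt_one (by linarith)]; linarith
  filter_upwards [h.eventually (lt_mem_nhds h1), hH.eventually_gt_atTop 0] with k hk hpos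
  have hpos' : (0 : ℝ) < ((nH k + nT k : ℕ) : ℝ) := by exact_mod_cast Nat.add_pos_left hpos _
  rw [div_lt_div_iff₀ (by linarith) hpos'] at hk
  push_cast at hk
  linarith

lemma tendsto_natCast_atTop {nH : ℕ → ℕ} (hH : Tendsto nH atTop atTop) :
    Tendsto (fun k => (nH k : ℝ)) atTop atTop :=
  tendsto_natCast_atTop_atTop.comp hH

lemma abs_floor_mul_sub_le {x ρ : ℝ} (hx : 0 ≤ x) (hρ : 0 ≤ ρ) (hρ2 : ρ ≤ 2) :
    |(⌊ρ * x⌋₊ : ℝ) - ρ * ⌊x⌋₊| ≤ 3 := by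
  have h1 := Nat.floor_le hx
  have h2 := Nat.lt_floor_add_one x
  have h3 := Nat.floor_le (mul_nonneg hρ hx)
  have h4 := Nat.lt_floor_add_one (ρ * x)
  have h5 : ρ * ⌊x⌋₊ ≤ ρ * x := by gcongr
  have h6 : ρ * x ≤ ρ * (⌊x⌋₊ + 1) := by gcongr
  rw [abs_le]
  constructor <;> nlinarith

/-- Up to a bounded error, the return times grow alternately by the factors `α` and `β`. -/
lemma OE.abs_sub_le {nH : ℕ → ℕ} {lamS lamU α β : ℝ} (h : OE nH lamS lamU α β) :
    (∀ p, 1 ≤ p → |(nH (2 * p + 1) : ℝ) - α * nH (2 * p)| ≤ 3) ∧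
    (∀ p, |(nH (2 * p + 2) : ℝ) - β * nH (2 * p + 1)| ≤ 3) := by
  obtain ⟨n₀, -, heven, hodd⟩ := h.growth
  have hα := h.one_lt
  have hβ := h.lt
  have hβ2 := h.lt_two
  have hα0 : 0 < α := by linarith
  have hβ0 : 0 < β := by linarith
  constructor
  · intro p hp
    rw [heven p hp, hodd p]
    have e : (n₀ : ℝ) * α ^ (p + 1) * β ^ p = α * (n₀ * α ^ p * β ^ p) := by ring
    rw [e]
    exact abs_floor_mul_sub_le (by positivity) hα0.le (by linarith)
  · intro p
    rw [show 2 * p + 2 = 2 * (p + 1) by ring, heven (p + 1) (by omega), hodd p]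
    have e : (n₀ : ℝ) * α ^ (p + 1) * β ^ (p + 1) = β * (n₀ * α ^ (p + 1) * β ^ p) := by ring
    rw [e]
    exact abs_floor_mul_sub_le (by positivity) hβ0.le hβ2.le

/-- The comparison of `lamS * lamU ^ (7 α / 2)` with `lamS * lamU ^ ((9 β - 6) / (2 - β))` forces
both growth factors to be close to `1`. -/
lemma OE.beta_lt {nH : ℕ → ℕ} {lamS lamU α β : ℝ} (h : OE nH lamS lamU α β) (hs : 0 < lamS)
    (hu : 1 < lamU) : β < 53 / 50 := by
  have h1 := lt_of_mul_lt_mul_left h.ineq₅ hs.le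
  rw [Real.rpow_lt_rpow_left_iff hu, div_lt_iff₀ (by linarith [h.lt_two])] at h1
  have h2 := h.one_lt
  have h3 := h.lt
  have h4 := h.lt_two
  -- With `α < β` the inequality becomes `7 * β ^ 2 + 4 * β - 12 < 0`.
  nlinarith [mul_pos (sub_pos.2 h3) (sub_pos.2 h4)]

/-- The properties of the `k`-th return on which the estimates rely: consecutive times `nH` differ by
a factor between `1` and `53 / 50`, and the factor `exp (c * nT k)`, all numerical constants and the
size `δ` of the linear region are negligible on the scale `exp (κ * nH k)`. -/
structure GoodScale (nH nT : ℕ → ℕ) (c κ δ : ℝ) (k : ℕ) : Prop where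
  mono : (nH k : ℝ) ≤ nH (k + 1)
  ratio : (nH (k + 1) : ℝ) ≤ 53 / 50 * nH k
  excursion : c * nT k ≤ κ * nH k
  large : 10 ≤ κ * nH k
  small : Real.exp (-(κ * nH k)) ≤ δ

lemma eventually_goodScale {nH nT : ℕ → ℕ} {lamS lamU α β : ℝ} (hO : OE nH lamS lamU α β)
    (hβ : β < 53 / 50) (hH : Tendsto nH atTop atTop)
    (hr : Tendsto (fun k => (nH k : ℝ) / ((nH k + nT k : ℕ) : ℝ)) atTop (𝓝 1))
    {c κ δ : ℝ} (hc : 0 ≤ c) (hκ : 0 < κ) (hδ : 0 < δ) :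
    ∀ᶠ k in atTop, GoodScale nH nT c κ δ k := by
  have hN := tendsto_natCast_atTop hH
  have hα1 := hO.one_lt
  have hαβ := hO.lt
  obtain ⟨he, ho⟩ := hO.abs_sub_le
  have hκN : Tendsto (fun k => κ * (nH k : ℝ)) atTop atTop := hN.const_mul_atTop hκ
  have hε : 0 < κ / (c + 1) := by positivity
  have hexp : Tendsto (fun k => Real.exp (-(κ * nH k))) atTop (𝓝 0) :=
    Real.tendsto_exp_atBot.comp (tendsto_neg_atTop_atBot.comp hκN)
  filter_upwards [eventually_ge_atTop 2, eventually_le_mul_of_tendsto_ratio hH hr hε,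
    hκN.eventually_ge_atTop 10, hexp.eventually (gt_mem_nhds hδ),
    hN.eventually_ge_atTop (3 / (α - 1)), hN.eventually_ge_atTop (3 / (53 / 50 - β))]
    with k hk h1 h2 h3 h4 h5
  rw [div_le_iff₀ (by linarith)] at h4 h5
  have hNk : (0 : ℝ) ≤ nH k := Nat.cast_nonneg _
  obtain ⟨ρ, hρα, hρβ, hρ⟩ : ∃ ρ, α ≤ ρ ∧ ρ ≤ β ∧ |(nH (k + 1) : ℝ) - ρ * nH k| ≤ 3 := by
    rcases Nat.even_or_odd' k with ⟨p, rfl | rfl⟩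
    · exact ⟨α, le_rfl, hαβ.le, he p (by omega)⟩
    · exact ⟨β, hαβ.le, le_rfl, ho p⟩
  obtain ⟨h6, h7⟩ := abs_le.1 hρ
  have h8 : α * nH k ≤ ρ * nH k := by gcongr
  have h9 : ρ * nH k ≤ β * nH k := by gcongr
  refine ⟨by linarith, by linarith, ?_, h2, h3.le⟩
  calc c * nT k ≤ c * (κ / (c + 1) * nH k) := by gcongr
    _ = κ * nH k * (c / (c + 1)) := by field_simp
    _ ≤ κ * nH k * 1 := by
        gcongr
        rw [div_le_one (by linarith)]; linarith
    _ = κ * nH k := mul_one _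

/-- The exponent gained over two returns by the admissible flatness `maxSlope`, after deducting the
flattening of a vector by `(lamU / lamS) ^ (nH (2 * p + 1) - nH (2 * p))`, grows linearly. With
`nH (2 * p + 1) ≈ α * nH (2 * p)` and `nH (2 * p + 2) ≈ α * β * nH (2 * p)` this rests on
`1 / 4 - α + 3 / 4 * α * β > 1 / 4 - α + 3 / 4 * α ^ 2 > 0`. -/
lemma eventually_steepness_gain {nH : ℕ → ℕ} {lamS lamU α β : ℝ} (hO : OE nH lamS lamU α β)
    (hβ : β < 53 / 50) (hH : Tendsto nH atTop atTop) :
    ∃ γ > 0, ∀ᶠ p in atTop, γ * nH (2 * p) ≤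
      (nH (2 * p) : ℝ) / 4 - nH (2 * p + 1) + 3 / 4 * nH (2 * p + 2) := by
  have hα1 := hO.one_lt
  have hαβ := hO.lt
  obtain ⟨he, ho⟩ := hO.abs_sub_le
  have hpos : 0 < 1 / 4 - α + 3 / 4 * (α * β) := by nlinarith
  refine ⟨(1 / 4 - α + 3 / 4 * (α * β)) / 2, by linarith, ?_⟩
  have hN : Tendsto (fun p => (nH (2 * p) : ℝ)) atTop atTop :=
    (tendsto_natCast_atTop hH).comp (tendsto_id.const_mul_atTop' (by norm_num))
  filter_upwards [eventually_ge_atTop 1,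
    hN.eventually_ge_atTop (6 / ((1 / 4 - α + 3 / 4 * (α * β)) / 2))] with p hp hbig
  rw [div_le_iff₀ (by linarith)] at hbig
  have h1 := (abs_le.1 (he p hp)).2
  have h2 := (abs_le.1 (ho p)).1
  nlinarith [mul_le_mul_of_nonneg_left h1 (show 0 ≤ 1 - 3 / 4 * β by linarith)]

/-- Growth at rate `x` for time `N` and at rate `y` for time `N' ≈ ρ N` has the mean rate
`(x + ρ y) / (1 + ρ)`, also after a loss of `C * (1 + s)` and a delay `s` which is negligible with
respect to `N`. -/
lemma eventually_mean_rate_le {N N' s : ℕ → ℝ} {ρ : ℝ} (hρ : 0 < ρ) (hN : Tendsto N atTop atTop)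
    (hN' : ∀ p, 0 ≤ N' p) (hs : ∀ p, 0 ≤ s p) (hρN : ∀ᶠ p in atTop, |N' p - ρ * N p| ≤ 3)
    (hsN : ∀ ε > 0, ∀ᶠ p in atTop, s p ≤ ε * N p) (x y C : ℝ) {ε : ℝ} (hε : 0 < ε) :
    ∀ᶠ p in atTop, ((x + ρ * y) / (1 + ρ) - ε) * (N p + N' p + s p) ≤
      x * N p + y * N' p - C * (1 + s p) := by
  set q := (x + ρ * y) / (1 + ρ) with hq
  have hB : 0 < ε / 2 / (|q| + |C| + 1) := by positivity
  filter_upwards [hρN, hsN _ hB,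
    hN.eventually_ge_atTop ((3 * (|y - x| / (1 + ρ)) + |C|) / (ε / 2))] with p h1 h2 h3
  rw [div_le_iff₀ (by positivity)] at h3
  rw [div_mul_eq_mul_div, le_div_iff₀ (by positivity)] at h2
  have e : x * N p + y * N' p - q * (N p + N' p + s p) =
      (y - x) / (1 + ρ) * (N' p - ρ * N p) - q * s p := by
    rw [hq]; field_simp; ring
  have h4 : |(y - x) / (1 + ρ) * (N' p - ρ * N p)| ≤ |y - x| / (1 + ρ) * 3 := by
    rw [abs_mul, abs_div, abs_of_pos (show 0 < 1 + ρ by linarith)]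
    gcongr
  have h5 := (abs_le.1 h4).1
  have h6 : q * s p ≤ |q| * s p := mul_le_mul_of_nonneg_right (le_abs_self q) (hs p)
  have h7 : C * (1 + s p) ≤ |C| * (1 + s p) :=
    mul_le_mul_of_nonneg_right (le_abs_self C) (by linarith [hs p])
  have h8 : 0 ≤ ε * (N' p + s p) := mul_nonneg hε.le (add_nonneg (hN' p) (hs p))
  nlinarith [hs p]

lemma eventually_le_mean_rate {N N' s : ℕ → ℝ} {ρ : ℝ} (hρ : 0 < ρ) (hN : Tendsto N atTop atTop)
    (hN' : ∀ p, 0 ≤ N' p) (hs : ∀ p, 0 ≤ s p) (hρN : ∀ᶠ p in atTop, |N' p - ρ * N p| ≤ 3)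
    (hsN : ∀ ε > 0, ∀ᶠ p in atTop, s p ≤ ε * N p) (x y C : ℝ) {ε : ℝ} (hε : 0 < ε) :
    ∀ᶠ p in atTop, x * N p + y * N' p + C * (1 + s p) ≤
      ((x + ρ * y) / (1 + ρ) + ε) * (N p + N' p + s p) := by
  filter_upwards [eventually_mean_rate_le hρ hN hN' hs hρN hsN (-x) (-y) C hε] with p hp
  have e : (-x + ρ * -y) / (1 + ρ) = -((x + ρ * y) / (1 + ρ)) := by
    rw [← neg_div]; ring_nf
  rw [e] at hp
  linarith

/-! ### Exponential scales -/

lemma const_mul_exp_lt {C x y : ℝ} (hC : C ≤ 64) (h : x + 10 ≤ y) :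
    C * Real.exp x < Real.exp y := by
  have h1 : (64 : ℝ) < Real.exp 10 := by
    have h2 := Real.add_one_lt_exp (show (1 : ℝ) ≠ 0 by norm_num)
    calc (64 : ℝ) < 2 ^ 10 := by norm_num
      _ ≤ Real.exp 1 ^ 10 := by gcongr; linarith
      _ = Real.exp 10 := by rw [← Real.exp_nat_mul]; norm_num
  calc C * Real.exp x ≤ 64 * Real.exp x := by gcongr
    _ < Real.exp 10 * Real.exp x := by gcongr
    _ = Real.exp (x + 10) := by rw [add_comm, Real.exp_add]
    _ ≤ Real.exp y := Real.exp_le_exp.2 h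

lemma pow_eq_exp_log_mul {a : ℝ} (ha : 0 < a) (n : ℕ) : a ^ n = Real.exp (Real.log a * n) := by
  rw [mul_comm, Real.exp_nat_mul, Real.exp_log ha]

/-- Half-width `(lamS / lamU ^ 3) ^ (N / 2)` of the box around the `k`-th return point, where
`N = nH k`. It lies between the size `(lamS / lamU) ^ nH (k - 1)` of the image of the previous box and
the size which `lamS ^ N` contracts below the half-height of the next box. -/
noncomputable def halfWidth (lamS lamU : ℝ) (N : ℕ) : ℝ :=
  Real.exp ((Real.log lamS - 3 * Real.log lamU) / 2 * N)

/-- Half-height `(lamS / lamU ^ 2) ^ N` of the box around the `k`-th return point, where `N = nH k`. After `N` iterates it is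
stretched to `(lamS / lamU) ^ N`. -/
noncomputable def halfHeight (lamS lamU : ℝ) (N : ℕ) : ℝ :=
  Real.exp ((Real.log lamS - 2 * Real.log lamU) * N)

/-- The largest ratio of the horizontal to the vertical component allowed at the `k`-th return, where
`N = nH k`. For the vertical component to dominate after two returns, the ratio has to be small with
respect to `(lamU / lamS) ^ N`; the fraction `3 / 4` of this exponent is one that persists. -/
noncomputable def maxSlope (lamS lamU : ℝ) (N : ℕ) : ℝ :=
  Real.exp (3 / 4 * (Real.log lamU - Real.log lamS) * N)

section Scales

variable {lamS lamU L κ δ : ℝ} {nH nT : ℕ → ℕ} {k : ℕ}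

lemma div_pow_eq_exp (hs : 0 < lamS) (hu : 0 < lamU) (N : ℕ) :
    lamS ^ N / lamU ^ N = Real.exp ((Real.log lamS - Real.log lamU) * N) := by
  rw [pow_eq_exp_log_mul hs, pow_eq_exp_log_mul hu, ← Real.exp_sub]; ring_nf

lemma pow_mul_halfHeight (hu : 0 < lamU) (N : ℕ) :
    lamU ^ N * halfHeight lamS lamU N = Real.exp ((Real.log lamS - Real.log lamU) * N) := by
  rw [pow_eq_exp_log_mul hu, halfHeight, ← Real.exp_add]; ring_nf

lemma pow_mul_halfWidth (hs : 0 < lamS) (N : ℕ) :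
    lamS ^ N * halfWidth lamS lamU N =
      Real.exp ((3 * Real.log lamS - 3 * Real.log lamU) / 2 * N) := by
  rw [pow_eq_exp_log_mul hs, halfWidth, ← Real.exp_add]; ring_nf

/-- The inequalities between the scales of consecutive boxes under which one return maps a box
into the next one. -/
lemma GoodScale.box_inequalities (hs : 0 < lamS) (hu : 1 < lamU)
    (hdis : Real.log lamS + 3 * Real.log lamU < 0) (hL : 1 ≤ L)
    (hκ : κ ≤ Real.log lamU / 100) (h : GoodScale nH nT (Real.log L) κ δ k) :
    halfWidth lamS lamU (nH k) ≤ δ ∧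
    lamU ^ nH k * halfHeight lamS lamU (nH k) ≤ δ ∧
    lamS ^ nH k * halfWidth lamS lamU (nH k) + lamU ^ nH k * halfHeight lamS lamU (nH k) ≤
      2 * (lamS ^ nH k / lamU ^ nH k) ∧
    2 * (L ^ nT k) ^ 2 * (2 * (lamS ^ nH k / lamU ^ nH k)) ≤ 1 ∧
    L ^ nT k * (2 * (lamS ^ nH k / lamU ^ nH k)) < halfWidth lamS lamU (nH (k + 1)) ∧
    L ^ nT k * (lamS ^ nH k * halfWidth lamS lamU (nH k)) +
      L ^ nT k * (2 * (lamS ^ nH k / lamU ^ nH k)) ^ 2 <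
        halfHeight lamS lamU (nH (k + 1)) := by
  have hu0 : 0 < lamU := by linarith
  have hL0 : 0 < L := by linarith
  have hl : 0 < Real.log lamU := Real.log_pos hu
  obtain ⟨h1, h2, h3, h4, h5⟩ := h
  set l := Real.log lamU
  set m := Real.log lamS
  set N : ℝ := (nH k : ℝ) with hN
  set N' : ℝ := (nH (k + 1) : ℝ) with hN'
  have hN0 : 0 ≤ N := Nat.cast_nonneg _
  have hκN : κ * N ≤ l / 100 * N := by gcongr
  have hlN : 0 ≤ l * N := by positivity
  have hmN : (m + 3 * l) * N ≤ 0 := mul_nonpos_of_nonpos_of_nonneg hdis.le hN0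
  have hprod : (-m - 3 * l) * N' ≤ (-m - 3 * l) * (53 / 50 * N) :=
    mul_le_mul_of_nonneg_left h2 (by linarith)
  have hprod' : l * N' ≤ l * (53 / 50 * N) := by gcongr
  refine ⟨?_, ?_, ?_, ?_, ?_, ?_⟩
  · refine le_trans (Real.exp_le_exp.2 ?_) h5
    linarith
  · rw [pow_mul_halfHeight hu0]
    refine le_trans (Real.exp_le_exp.2 ?_) h5
    linarith
  · rw [pow_mul_halfHeight hu0, pow_mul_halfWidth hs, div_pow_eq_exp hs hu0, two_mul]
    gcongr 1
    refine Real.exp_le_exp.2 ?_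
    linarith
  · rw [div_pow_eq_exp hs hu0, pow_eq_exp_log_mul hL0, ← Real.exp_nat_mul]
    have e : ∀ x y : ℝ, 2 * Real.exp x * (2 * Real.exp y) = 4 * Real.exp (x + y) := by
      intro x y; rw [Real.exp_add]; ring
    rw [e, ← Real.exp_zero]
    refine (const_mul_exp_lt (by norm_num) ?_).le
    push_cast
    linarith
  · rw [div_pow_eq_exp hs hu0, pow_eq_exp_log_mul hL0, halfWidth]
    have e : ∀ x y : ℝ, Real.exp x * (2 * Real.exp y) = 2 * Real.exp (x + y) := by
      intro x y; rw [Real.exp_add]; ring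
    rw [e]
    refine const_mul_exp_lt (by norm_num) ?_
    linarith
  · rw [pow_mul_halfWidth hs, div_pow_eq_exp hs hu0, pow_eq_exp_log_mul hL0, halfHeight]
    have e : ∀ x y z : ℝ, Real.exp x * Real.exp y + Real.exp x * (2 * Real.exp z) ^ 2 =
        (2 * Real.exp (x + y) + 8 * Real.exp (x + 2 * z)) / 2 := by
      intro x y z
      rw [two_mul z, Real.exp_add, Real.exp_add, Real.exp_add]; ring
    rw [e]
    have i1 : ∀ x, x + 10 ≤ (m - 2 * l) * N' → 2 * Real.exp x < Real.exp ((m - 2 * l) * N') :=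
      fun x hx => const_mul_exp_lt (by norm_num) hx
    have i2 : ∀ x, x + 10 ≤ (m - 2 * l) * N' → 8 * Real.exp x < Real.exp ((m - 2 * l) * N') :=
      fun x hx => const_mul_exp_lt (by norm_num) hx
    have j1 := i1 (Real.log L * nT k + (3 * m - 3 * l) / 2 * N) (by linarith)
    have j2 := i2 (Real.log L * nT k + 2 * ((m - l) * N)) (by linarith)
    linarith

/-- The inequalities under which steep vectors stay steep over two returns. -/
lemma GoodScale.slope_inequalities (hs : 0 < lamS) (hu : 1 < lamU)
    (hdis : Real.log lamS + 3 * Real.log lamU < 0) (hL : 1 ≤ L)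
    (hκ : κ ≤ Real.log lamU / 100) {γ : ℝ}
    (hκγ : κ ≤ (Real.log lamU - Real.log lamS) * γ / 100)
    (h : GoodScale nH nT (Real.log L) κ δ k) (h' : GoodScale nH nT (Real.log L) κ δ (k + 1))
    (hγ : γ * nH k ≤ (nH k : ℝ) / 4 - nH (k + 1) + 3 / 4 * nH (k + 2)) :
    56 * (L ^ nT k) ^ 2 * (L ^ nT (k + 1)) ^ 2 * (lamS ^ nH k / lamU ^ nH k) *
      maxSlope lamS lamU (nH k) ≤ 1 ∧
    40 * (L ^ nT k) ^ 2 * (L ^ nT (k + 1)) ^ 2 *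
      (lamU ^ nH (k + 1) / lamS ^ nH (k + 1) * (lamS ^ nH k / lamU ^ nH k)) *
      maxSlope lamS lamU (nH k) ≤ maxSlope lamS lamU (nH (k + 2)) := by
  have hu0 : 0 < lamU := by linarith
  have hL0 : 0 < L := by linarith
  have hl : 0 < Real.log lamU := Real.log_pos hu
  obtain ⟨h1, h2, h3, h4, h5⟩ := h
  have h3' := h'.excursion
  rw [← inv_div (lamS ^ nH (k + 1)), div_pow_eq_exp hs hu0, div_pow_eq_exp hs hu0,
    pow_eq_exp_log_mul hL0, pow_eq_exp_log_mul hL0, maxSlope, maxSlope, ← Real.exp_neg]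
  set l := Real.log lamU
  set m := Real.log lamS
  set N : ℝ := (nH k : ℝ) with hN
  set N' : ℝ := (nH (k + 1) : ℝ) with hN'
  set N'' : ℝ := (nH (k + 2) : ℝ) with hN''
  set q := Real.log L * nT k
  set q' := Real.log L * nT (k + 1)
  have hN0 : 0 ≤ N := Nat.cast_nonneg _
  have hκ0 : 0 ≤ κ := by
    by_contra hneg
    nlinarith
  have hκN : κ * N ≤ l / 100 * N := by gcongr
  have hκN' : κ * N' ≤ κ * (53 / 50 * N) := by gcongr
  have hlN : 0 ≤ l * N := by positivity
  have hmN : (m + 3 * l) * N ≤ 0 := mul_nonpos_of_nonpos_of_nonneg hdis.le hN0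
  constructor
  · have e : 56 * Real.exp q ^ 2 * Real.exp q' ^ 2 * Real.exp ((m - l) * N) *
        Real.exp (3 / 4 * (l - m) * N) =
        56 * Real.exp (q + q + (q' + q') + (m - l) * N + 3 / 4 * (l - m) * N) := by
      simp only [Real.exp_add]; ring
    rw [e, ← Real.exp_zero]
    refine (const_mul_exp_lt (by norm_num) ?_).le
    linarith
  · have e : 40 * Real.exp q ^ 2 * Real.exp q' ^ 2 *
        (Real.exp (-((m - l) * N')) * Real.exp ((m - l) * N)) * Real.exp (3 / 4 * (l - m) * N) =
        40 * Real.exp (q + q + (q' + q') + (-((m - l) * N') + (m - l) * N) +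
          3 / 4 * (l - m) * N) := by
      simp only [Real.exp_add]; ring
    rw [e]
    refine (const_mul_exp_lt (by norm_num) ?_).le
    have hlm : 0 < l - m := by linarith
    have k1 := mul_le_mul_of_nonneg_left hγ hlm.le
    have k2 : κ * N ≤ (l - m) * γ / 100 * N := by gcongr
    linarith

end Scales

/-! ### Growth of tangent vectors along the returns -/

section Vectors

variable {lamS lamU L κ δ γ : ℝ} {nH nT : ℕ → ℕ} {p₀ : ℕ} {w : ℕ → Plane}

/-- A tangent vector which is steep at an even return stays steep at all later even returns. Its
vertical component is expanded at even returns and contracted at odd ones, and no component grows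
faster than by contraction at even returns and expansion at odd ones. -/
lemma vector_growth (hs : 0 < lamS) (hs' : lamS ≤ 1) (hu : 1 < lamU)
    (hdis : Real.log lamS + 3 * Real.log lamU < 0) (hL : 1 ≤ L)
    (hκ : κ ≤ Real.log lamU / 100) (hκγ : κ ≤ (Real.log lamU - Real.log lamS) * γ / 100)
    (hgood : ∀ k ≥ 2 * p₀, GoodScale nH nT (Real.log L) κ δ k)
    (hγ : ∀ p ≥ p₀, γ * nH (2 * p) ≤
      (nH (2 * p) : ℝ) / 4 - nH (2 * p + 1) + 3 / 4 * nH (2 * p + 2))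
    (hw : ∀ k ≥ 2 * p₀, ∃ A, NearlyTurns A (L ^ nT k) (2 * (lamS ^ nH k / lamU ^ nH k)) ∧
      w (k + 1) = A (diagMap (lamS ^ nH k) (lamU ^ nH k) (w k)))
    (hinit : |w (2 * p₀) 0| < |w (2 * p₀) 1|) {p : ℕ} (hp : p₀ ≤ p) :
    0 < |w (2 * p) 1| ∧
    1 / (8 * L ^ nT (2 * p) * L ^ nT (2 * p + 1)) * (lamS ^ nH (2 * p + 1) * lamU ^ nH (2 * p)) *
      |w (2 * p) 1| ≤ |w (2 * p + 2) 1| ∧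
    ∀ i, |w (2 * p + 2) i| ≤ 5 * L ^ nT (2 * p) * L ^ nT (2 * p + 1) *
      (lamU ^ nH (2 * p + 1) * lamS ^ nH (2 * p)) * max |w (2 * p) 0| |w (2 * p) 1| := by
  have hu0 : 0 < lamU := by linarith
  have hL0 : 0 < L := by linarith
  have hslope1 : ∀ k, 1 ≤ maxSlope lamS lamU k := by
    intro k
    have hl : 0 < Real.log lamU := Real.log_pos hu
    refine Real.one_le_exp (mul_nonneg ?_ (Nat.cast_nonneg k))
    linarith
  have step : ∀ p ≥ p₀, |w (2 * p) 0| ≤ maxSlope lamS lamU (nH (2 * p)) * |w (2 * p) 1| →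
      1 / (8 * L ^ nT (2 * p) * L ^ nT (2 * p + 1)) *
        (lamS ^ nH (2 * p + 1) * lamU ^ nH (2 * p)) * |w (2 * p) 1| ≤ |w (2 * p + 2) 1| ∧
      ∀ i, |w (2 * p + 2) i| ≤ 5 * L ^ nT (2 * p) * L ^ nT (2 * p + 1) *
        (lamU ^ nH (2 * p + 1) * lamS ^ nH (2 * p)) * max |w (2 * p) 0| |w (2 * p) 1| := by
    intro p hp hsl
    obtain ⟨A, hA, hwA⟩ := hw (2 * p) (by omega)
    obtain ⟨A', hA', hwA'⟩ := hw (2 * p + 1) (by omega)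
    have h1 := hgood (2 * p) (by omega)
    have h2 := hgood (2 * p + 1) (by omega)
    have h3 := (h1.slope_inequalities hs hu hdis hL hκ hκγ h2 (hγ p hp)).1
    have hle : nH (2 * p) ≤ nH (2 * p + 1) := by exact_mod_cast h1.mono
    rw [hwA] at hwA'
    rw [hwA']
    refine ⟨abs_vertical_two_returns_ge (by positivity) (by positivity) (by positivity)
      (by positivity) (by positivity) (by positivity) hA hA' (hslope1 _) h3 hsl, fun i => ?_⟩
    refine abs_two_returns_le (by positivity) (by positivity) (by positivity) (by positivity)
      ((pow_le_one₀ hs.le hs').trans (one_le_pow₀ hu.le)) ?_ hA hA' (le_max_left _ _)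
      (le_max_right _ _) i
    rw [mul_comm]
    exact mul_le_mul (pow_le_pow_right₀ hu.le hle) (pow_le_pow_of_le_one hs.le hs' hle)
      (by positivity) (by positivity)
  have inv : ∀ p ≥ p₀, 0 < |w (2 * p) 1| ∧
      |w (2 * p) 0| ≤ maxSlope lamS lamU (nH (2 * p)) * |w (2 * p) 1| := by
    intro p hp
    induction p, hp using Nat.le_induction with
    | base =>
      exact ⟨(abs_nonneg _).trans_lt hinit,
        hinit.le.trans (le_mul_of_one_le_left (abs_nonneg _) (hslope1 _))⟩
    | succ p hp ih =>
      obtain ⟨h1, h2⟩ := step p hp ih.2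
      have hpos : 0 < |w (2 * p + 2) 1| := lt_of_lt_of_le (by have := ih.1; positivity) h1
      refine ⟨hpos, ?_⟩
      have h3 := (hgood (2 * p) (by omega)).slope_inequalities hs hu hdis hL hκ hκγ
        (hgood (2 * p + 1) (by omega)) (hγ p hp)
      have h4 : max |w (2 * p) 0| |w (2 * p) 1| ≤
          maxSlope lamS lamU (nH (2 * p)) * |w (2 * p) 1| :=
        max_le ih.2 (le_mul_of_one_le_left (abs_nonneg _) (hslope1 _))
      set Q := L ^ nT (2 * p)
      set Q' := L ^ nT (2 * p + 1)
      set S := lamS ^ nH (2 * p)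
      set T := lamU ^ nH (2 * p)
      set S' := lamS ^ nH (2 * p + 1)
      set T' := lamU ^ nH (2 * p + 1)
      set R := maxSlope lamS lamU (nH (2 * p))
      have hQ : 0 < Q := by positivity
      have hQ' : 0 < Q' := by positivity
      have hS : 0 < S := by positivity
      have hT : 0 < T := by positivity
      have hS' : 0 < S' := by positivity
      have hT' : 0 < T' := by positivity
      have hR : 0 < R := by linarith [hslope1 (nH (2 * p))]
      calc |w (2 * p + 2) 0| ≤ 5 * Q * Q' * (T' * S) * (R * |w (2 * p) 1|) :=
            (h2 0).trans (by gcongr)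
        _ = 40 * Q ^ 2 * Q' ^ 2 * (T' / S' * (S / T)) * R *
            (1 / (8 * Q * Q') * (S' * T) * |w (2 * p) 1|) := by field_simp; ring
        _ ≤ maxSlope lamS lamU (nH (2 * p + 2)) * |w (2 * p + 2) 1| :=
          mul_le_mul h3.2 h1 (by positivity) (Real.exp_pos _).le
  exact ⟨(inv p hp).1, step p hp (inv p hp).2⟩

end Vectors

/-! ### Finite-time exponents -/

section Exponents

variable {M : Type*} [TopologicalSpace M] [ChartedSpace Plane M] [IsManifold (𝓡 2) 1 M]

/-- The finite-time exponent at a time when the orbit is in a compact part of the coordinate domain,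
in terms of the derivative in coordinates. -/
lemma finiteTimeExponent_bounds
    {g : Bundle.ContinuousRiemannianMetric Plane (fun x : M => TangentSpace (𝓡 2) x)}
    {φ : OpenPartialHomeomorph M Plane} (hφ : φ.MDifferentiable (𝓡 2) (𝓡 2)) {K : Set Plane}
    {c C : ℝ} (hc : 0 < c) (hC : 0 < C)
    (hg : ∀ p ∈ K, ∀ v : Plane, c * ‖v‖ ^ 2 ≤
        g.inner (φ.symm p) (coordVector φ (φ.symm p) v) (coordVector φ (φ.symm p) v) ∧
      g.inner (φ.symm p) (coordVector φ (φ.symm p) v) (coordVector φ (φ.symm p) v) ≤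
        C * ‖v‖ ^ 2)
    {f : M → M} {n : ℕ} (hf : MDifferentiable (𝓡 2) (𝓡 2) f^[n]) {x : M} (hx : x ∈ φ.source)
    (hdom : φ x ∈ repDomain φ φ f^[n]) (hmem : rep φ φ f^[n] (φ x) ∈ K)
    {A : Plane →L[ℝ] Plane} (hA : HasFDerivAt (rep φ φ f^[n]) A (φ x)) {v : Plane}
    (hv : A v ≠ 0) :
    (Real.log ‖A v‖ + Real.log c / 2) / n ≤ finiteTimeExponent g f x (coordVector φ x v) n ∧
    finiteTimeExponent g f x (coordVector φ x v) n ≤ (Real.log ‖A v‖ + Real.log C / 2) / n := by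
  have hfx : f^[n] x ∈ φ.source := by
    have := hdom.2
    rwa [mem_preimage, mem_preimage, φ.left_inv hx] at this
  rw [rep_apply _ _ hx] at hmem
  obtain ⟨h1, h2⟩ := hg _ hmem (A v)
  rw [φ.left_inv hfx] at h1 h2
  have hn : 0 < ‖A v‖ := norm_pos_iff.2 hv
  have hlog : ∀ a > 0, Real.log (a * ‖A v‖ ^ 2) / 2 = Real.log ‖A v‖ + Real.log a / 2 := by
    intro a ha
    rw [Real.log_mul ha.ne' (by positivity), Real.log_pow]
    push_cast
    ring
  have hpos : 0 < c * ‖A v‖ ^ 2 := by positivity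
  rw [finiteTimeExponent, mfderiv_coordVector hφ hf hx hfx hA,
    Real.log_sqrt (hpos.le.trans h1), ← hlog c hc, ← hlog C hC]
  exact ⟨by gcongr, by gcongr; exact hpos.trans_le h1⟩

end Exponents

/-! ### The orbit of a box -/

section Orbit

variable {M : Type*} [TopologicalSpace M]

/-- The number of iterates of `f` from the return `k₀` to the return `k₀ + i`. -/
def returnTime (nH nT : ℕ → ℕ) (k₀ : ℕ) : ℕ → ℕ
  | 0 => 0
  | i + 1 => nT (k₀ + i) + nH (k₀ + i) + returnTime nH nT k₀ i

/-- The orbit of a point of the first box through the boxes `B k`, with the derivatives in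
coordinates. -/
lemma exists_orbit_derivatives {f : M → M} (hf : Continuous f)
    {φ : OpenPartialHomeomorph M Plane} {nH nT : ℕ → ℕ} {k₀ : ℕ} {B : ℕ → Set Plane}
    {K : Set Plane} (hB : ∀ k, k₀ ≤ k → B k ⊆ K) {E : ℕ → Plane →L[ℝ] Plane} {Q d : ℕ → ℝ}
    (hstep : ∀ k, k₀ ≤ k → ∀ p ∈ B k, p ∈ repDomain φ φ f^[nH k] ∧
      HasFDerivAt (rep φ φ f^[nH k]) (E k) p ∧ rep φ φ f^[nH k] p ∈ K ∧
      p ∈ repDomain φ φ f^[nT k + nH k] ∧ rep φ φ f^[nT k + nH k] p ∈ B (k + 1) ∧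
      ∃ A, NearlyTurns A (Q k) (d k) ∧ HasFDerivAt (rep φ φ f^[nT k + nH k]) (A.comp (E k)) p)
    (hKt : K ⊆ φ.target) {p : Plane} (hp : p ∈ B k₀) :
    ∃ D : ℕ → Plane →L[ℝ] Plane, D 0 = ContinuousLinearMap.id ℝ Plane ∧
      (∀ i, ∃ A, NearlyTurns A (Q (k₀ + i)) (d (k₀ + i)) ∧
        D (i + 1) = A.comp ((E (k₀ + i)).comp (D i))) ∧
      (∀ i, p ∈ repDomain φ φ f^[returnTime nH nT k₀ i] ∧
        rep φ φ f^[returnTime nH nT k₀ i] p ∈ K ∧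
        HasFDerivAt (rep φ φ f^[returnTime nH nT k₀ i]) (D i) p) ∧
      ∀ i, p ∈ repDomain φ φ f^[nH (k₀ + i) + returnTime nH nT k₀ i] ∧
        rep φ φ f^[nH (k₀ + i) + returnTime nH nT k₀ i] p ∈ K ∧
        HasFDerivAt (rep φ φ f^[nH (k₀ + i) + returnTime nH nT k₀ i])
          ((E (k₀ + i)).comp (D i)) p := by
  have main : ∀ i, p ∈ repDomain φ φ f^[returnTime nH nT k₀ i] ∧
      rep φ φ f^[returnTime nH nT k₀ i] p ∈ B (k₀ + i) ∧
      DifferentiableAt ℝ (rep φ φ f^[returnTime nH nT k₀ i]) p := by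
    intro i
    induction i with
    | zero =>
      have hpt : p ∈ φ.target := hKt (hB k₀ le_rfl hp)
      have hid : ∀ q ∈ φ.target, rep φ φ f^[returnTime nH nT k₀ 0] q = q := fun q hq => by
        simp [rep, returnTime, φ.right_inv hq]
      refine ⟨⟨hpt, by simpa [returnTime] using φ.map_target hpt⟩, ?_, ?_⟩
      · rw [hid p hpt]; exact hp
      · refine differentiableAt_id.congr_of_eventuallyEq ?_
        filter_upwards [φ.open_target.mem_nhds hpt] with q hq using hid q hq
    | succ i ih =>
      obtain ⟨h1, h2, h3⟩ := ih
      obtain ⟨-, -, -, h4, h5, A, -, h6⟩ := hstep (k₀ + i) (by omega) _ h2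
      rw [returnTime, Function.iterate_add]
      refine ⟨mem_repDomain_comp h1 h4, ?_, ?_⟩
      · rw [rep_comp_apply h1]; exact h5
      · exact (hasFDerivAt_rep_comp (hf.iterate _) h1 h3.hasFDerivAt h6).differentiableAt
  refine ⟨fun i => fderiv ℝ (rep φ φ f^[returnTime nH nT k₀ i]) p, ?_, fun i => ?_, fun i => ?_,
    fun i => ?_⟩
  · have hpt : p ∈ φ.target := hKt (hB k₀ le_rfl hp)
    refine HasFDerivAt.fderiv ((hasFDerivAt_id p).congr_of_eventuallyEq ?_)
    filter_upwards [φ.open_target.mem_nhds hpt] with q hq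
    simp [rep, returnTime, φ.right_inv hq]
  · obtain ⟨h1, h2, h3⟩ := main i
    obtain ⟨-, -, -, h4, h5, A, hA, h6⟩ := hstep (k₀ + i) (by omega) _ h2
    refine ⟨A, hA, ?_⟩
    simp only [returnTime]
    rw [Function.iterate_add]
    exact (hasFDerivAt_rep_comp (hf.iterate _) h1 h3.hasFDerivAt h6).fderiv
  · obtain ⟨h1, h2, h3⟩ := main i
    exact ⟨h1, hB _ (by omega) h2, h3.hasFDerivAt⟩
  · obtain ⟨h1, h2, h3⟩ := main i
    obtain ⟨h4, h5, h6, -⟩ := hstep (k₀ + i) (by omega) _ h2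
    rw [Function.iterate_add]
    exact ⟨mem_repDomain_comp h1 h4, by rwa [rep_comp_apply h1],
      hasFDerivAt_rep_comp (hf.iterate _) h1 h3.hasFDerivAt h5⟩

end Orbit

/-! ### Upper and lower exponents -/

lemma returnTime_two_mul_succ (nH nT : ℕ → ℕ) (p₀ j : ℕ) :
    returnTime nH nT (2 * p₀) (2 * (j + 1)) =
      nT (2 * (p₀ + j) + 1) + nH (2 * (p₀ + j) + 1) +
        (nT (2 * (p₀ + j)) + nH (2 * (p₀ + j)) + returnTime nH nT (2 * p₀) (2 * j)) := by
  rw [show 2 * (j + 1) = 2 * j + 1 + 1 by ring, returnTime, returnTime,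
    show 2 * p₀ + (2 * j + 1) = 2 * (p₀ + j) + 1 by ring,
    show 2 * p₀ + 2 * j = 2 * (p₀ + j) by ring]

lemma tendsto_returnTime_two_mul {nH nT : ℕ → ℕ} {k₀ : ℕ} (h : ∀ k ≥ k₀, 0 < nH k) :
    Tendsto (fun j => returnTime nH nT k₀ (2 * j)) atTop atTop := by
  have hle : ∀ i, i ≤ returnTime nH nT k₀ i := by
    intro i
    induction i with
    | zero => exact Nat.zero_le _
    | succ i ih =>
      have := h (k₀ + i) (by omega)
      rw [returnTime]
      omega
  exact tendsto_atTop_mono (fun j => (show j ≤ 2 * j by omega).trans (hle (2 * j))) tendsto_id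

section Growth

variable {lamS lamU L κ δ α β : ℝ} {nH nT : ℕ → ℕ} {p₀ : ℕ} {w : ℕ → Plane} {e : ℕ → ℝ}

/-- The times `nT` of two consecutive returns are negligible. -/
lemma eventually_excursions_le (hH : Tendsto nH atTop atTop)
    (hr : Tendsto (fun k => (nH k : ℝ) / ((nH k + nT k : ℕ) : ℝ)) atTop (𝓝 1))
    {c : ℝ} (hgood : ∀ k ≥ 2 * p₀, GoodScale nH nT c κ δ k) {ε : ℝ} (hε : 0 < ε) :
    ∀ᶠ p in atTop, (nT (2 * p) + nT (2 * p + 1) : ℝ) ≤ ε * nH (2 * p) := by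
  have h1 := eventually_le_mul_of_tendsto_ratio hH hr (show 0 < ε / 4 by linarith)
  have h2 : Tendsto (fun p : ℕ => 2 * p) atTop atTop :=
    tendsto_id.const_mul_atTop' (by norm_num)
  filter_upwards [h2.eventually h1, ((tendsto_add_atTop_nat 1).comp h2).eventually h1,
    eventually_ge_atTop p₀] with p hp hp' hge
  have h3 := (hgood (2 * p) (by omega)).ratio
  simp only [Function.comp_apply] at hp'
  have h4 : ε / 4 * nH (2 * p + 1) ≤ ε / 4 * (53 / 50 * nH (2 * p)) := by gcongr
  have h5 : 0 ≤ ε * nH (2 * p) := by positivity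
  linarith

/-- At the even returns, the exponent of a vector growing as in `vector_growth` is at most the rate of
contraction followed by an expansion `α` times as long. -/
lemma frequently_exponent_le (hO : OE nH lamS lamU α β) (hs : 0 < lamS) (hu : 0 < lamU)
    (hL : 1 ≤ L) (hH : Tendsto nH atTop atTop)
    (hr : Tendsto (fun k => (nH k : ℝ) / ((nH k + nT k : ℕ) : ℝ)) atTop (𝓝 1))
    (hpos : ∀ k ≥ 2 * p₀, 0 < nH k)
    (hgood : ∀ k ≥ 2 * p₀, GoodScale nH nT (Real.log L) κ δ k)
    (hw0 : ∀ p, p₀ ≤ p → 0 < |w (2 * p) 1|)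
    (hw : ∀ p, p₀ ≤ p → ∀ i, |w (2 * p + 2) i| ≤ 5 * L ^ nT (2 * p) * L ^ nT (2 * p + 1) *
      (lamU ^ nH (2 * p + 1) * lamS ^ nH (2 * p)) * max |w (2 * p) 0| |w (2 * p) 1|) {b : ℝ}
    (he : ∀ j, e (returnTime nH nT (2 * p₀) (2 * j)) ≤
      (Real.log ‖w (2 * (p₀ + j))‖ + b) / returnTime nH nT (2 * p₀) (2 * j)) {ε : ℝ}
    (hε : 0 < ε) :
    ∃ᶠ n in atTop, e n ≤ (α * Real.log lamU + Real.log lamS) / (1 + α) + ε := by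
  have hτ := tendsto_returnTime_two_mul (nT := nT) hpos
  have hτ' : Tendsto (fun j => (returnTime nH nT (2 * p₀) (2 * j) : ℝ)) atTop atTop :=
    tendsto_natCast_atTop_atTop.comp hτ
  have hL0 : 0 < L := by linarith
  have hlogL : 0 ≤ Real.log L := Real.log_nonneg hL
  have hα : 0 < α := by linarith [hO.one_lt]
  have hN : Tendsto (fun p => (nH (2 * p) : ℝ)) atTop atTop :=
    (tendsto_natCast_atTop hH).comp (tendsto_id.const_mul_atTop' (by norm_num))
  set z : ℕ → ℝ := fun j => Real.log (max |w (2 * (p₀ + j)) 0| |w (2 * (p₀ + j)) 1|) with hz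
  have hmax : ∀ p, p₀ ≤ p → 0 < max |w (2 * p) 0| |w (2 * p) 1| := fun p hp =>
    lt_max_of_lt_right (hw0 p hp)
  have hrate := eventually_le_mean_rate hα hN (N' := fun p => (nH (2 * p + 1) : ℝ))
    (s := fun p => (nT (2 * p) + nT (2 * p + 1) : ℝ)) (fun p => Nat.cast_nonneg _)
    (fun p => by positivity)
    ((eventually_ge_atTop 1).mono fun p hp => hO.abs_sub_le.1 p hp)
    (fun ε hε => eventually_excursions_le hH hr hgood hε)
    (Real.log lamS) (Real.log lamU) (Real.log 5 + Real.log L) (show 0 < ε / 2 by linarith)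
  have hrate' := (tendsto_add_atTop_nat p₀).eventually hrate
  have hz' : ∀ᶠ j in atTop, z (j + 1) - z j ≤
      ((Real.log lamS + α * Real.log lamU) / (1 + α) + ε / 2) *
        ((returnTime nH nT (2 * p₀) (2 * (j + 1)) : ℝ) -
          returnTime nH nT (2 * p₀) (2 * j)) := by
    filter_upwards [hrate'] with j hj
    rw [add_comm j p₀] at hj
    have hm := hmax (p₀ + j) (by omega)
    have hm' := hmax (p₀ + j + 1) (by omega)
    have h1 : max |w (2 * (p₀ + j + 1)) 0| |w (2 * (p₀ + j + 1)) 1| ≤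
        5 * L ^ nT (2 * (p₀ + j)) * L ^ nT (2 * (p₀ + j) + 1) *
        (lamU ^ nH (2 * (p₀ + j) + 1) * lamS ^ nH (2 * (p₀ + j))) *
        max |w (2 * (p₀ + j)) 0| |w (2 * (p₀ + j)) 1| :=
      max_le (hw (p₀ + j) (by omega) 0) (hw (p₀ + j) (by omega) 1)
    have h2 := Real.log_le_log hm' h1
    rw [Real.log_mul (by positivity) (by positivity), Real.log_mul (by positivity) (by positivity),
      Real.log_mul (by positivity) (by positivity), Real.log_mul (by positivity) (by positivity),
      Real.log_mul (by positivity) (by positivity), Real.log_pow, Real.log_pow, Real.log_pow,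
      Real.log_pow] at h2
    rw [returnTime_two_mul_succ]
    push_cast
    have h3 : 0 ≤ Real.log 5 := Real.log_nonneg (by norm_num)
    have h4 : 0 ≤ Real.log 5 * (nT (2 * (p₀ + j)) + nT (2 * (p₀ + j) + 1) : ℝ) := by positivity
    simp only [hz, ← add_assoc]
    refine le_trans ?_ (hj.trans (le_of_eq (by ring)))
    linarith
  have hfin := eventually_div_le_add hτ' hz' (Real.log 2 + b) (show 0 < ε / 2 by linarith)
  refine hτ.frequently (Eventually.frequently ?_)
  filter_upwards [hfin, hτ'.eventually_gt_atTop 0] with j hj hposj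
  refine (he j).trans (le_trans ?_ (hj.trans (le_of_eq (by ring))))
  have hm := hmax (p₀ + j) (by omega)
  have h5 : ‖w (2 * (p₀ + j))‖ ≤ 2 * max |w (2 * (p₀ + j)) 0| |w (2 * (p₀ + j)) 1| := by
    have h6 := le_max_left |w (2 * (p₀ + j)) 0| |w (2 * (p₀ + j)) 1|
    have h7 := le_max_right |w (2 * (p₀ + j)) 0| |w (2 * (p₀ + j)) 1|
    linarith [norm_le_abs_add_abs (w (2 * (p₀ + j)))]
  have h8 : 0 < ‖w (2 * (p₀ + j))‖ :=
    (hw0 (p₀ + j) (by omega)).trans_le (abs_apply_le_norm _ _)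
  have h9 := Real.log_le_log h8 h5
  rw [Real.log_mul (by norm_num) hm.ne'] at h9
  refine div_le_div_of_nonneg_right ?_ hposj.le
  simp only [hz]
  linarith

/-- Just after the expansion at the even returns, the exponent of a vector growing as in
`vector_growth` is at least the rate of contraction followed by an expansion `β` times as long. -/
lemma frequently_le_exponent (hO : OE nH lamS lamU α β) (hs : 0 < lamS) (hu : 0 < lamU)
    (hL : 1 ≤ L) (hH : Tendsto nH atTop atTop)
    (hr : Tendsto (fun k => (nH k : ℝ) / ((nH k + nT k : ℕ) : ℝ)) atTop (𝓝 1))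
    (hpos : ∀ k ≥ 2 * p₀, 0 < nH k)
    (hgood : ∀ k ≥ 2 * p₀, GoodScale nH nT (Real.log L) κ δ k)
    (hw0 : ∀ p, p₀ ≤ p → 0 < |w (2 * p) 1|)
    (hw : ∀ p, p₀ ≤ p → 1 / (8 * L ^ nT (2 * p) * L ^ nT (2 * p + 1)) *
      (lamS ^ nH (2 * p + 1) * lamU ^ nH (2 * p)) * |w (2 * p) 1| ≤ |w (2 * p + 2) 1|) {a : ℝ}
    (he : ∀ j, (Real.log ‖diagMap (lamS ^ nH (2 * (p₀ + j))) (lamU ^ nH (2 * (p₀ + j)))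
        (w (2 * (p₀ + j)))‖ + a) /
        ((nH (2 * (p₀ + j)) + returnTime nH nT (2 * p₀) (2 * j) : ℕ) : ℝ) ≤
      e (nH (2 * (p₀ + j)) + returnTime nH nT (2 * p₀) (2 * j))) {ε : ℝ}
    (hε : 0 < ε) :
    ∃ᶠ n in atTop, (β * Real.log lamU + Real.log lamS) / (1 + β) - ε ≤ e n := by
  have hτ : Tendsto (fun j => nH (2 * (p₀ + j)) + returnTime nH nT (2 * p₀) (2 * j))
      atTop atTop :=
    tendsto_atTop_mono (fun j => Nat.le_add_left _ _) (tendsto_returnTime_two_mul (nT := nT) hpos)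
  have hτ' : Tendsto (fun j => ((nH (2 * (p₀ + j)) + returnTime nH nT (2 * p₀) (2 * j) : ℕ) : ℝ))
      atTop atTop := tendsto_natCast_atTop_atTop.comp hτ
  have hL0 : 0 < L := by linarith
  have hlogL : 0 ≤ Real.log L := Real.log_nonneg hL
  have hβ : 0 < β := by linarith [hO.one_lt, hO.lt]
  have hN : Tendsto (fun p => (nH (2 * p + 1) : ℝ)) atTop atTop :=
    (tendsto_natCast_atTop hH).comp ((tendsto_add_atTop_nat 1).comp
      (tendsto_id.const_mul_atTop' (by norm_num)))
  -- Including the current expansion in `z` pairs the contraction at the return `2 * p + 1` with the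
  -- longer expansion at the return `2 * p + 2`.
  set z : ℕ → ℝ := fun j =>
    Real.log lamU * nH (2 * (p₀ + j)) + Real.log |w (2 * (p₀ + j)) 1| with hz
  have hrate := eventually_mean_rate_le hβ hN (N' := fun p => (nH (2 * p + 2) : ℝ))
    (s := fun p => (nT (2 * p) + nT (2 * p + 1) : ℝ)) (fun p => Nat.cast_nonneg _)
    (fun p => by positivity) (Eventually.of_forall hO.abs_sub_le.2)
    (fun ε hε => by
      filter_upwards [eventually_excursions_le hH hr hgood hε, eventually_ge_atTop p₀]
        with p hp hge
      have := (hgood (2 * p) (by omega)).mono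
      exact hp.trans (by gcongr))
    (Real.log lamS) (Real.log lamU) (Real.log 8 + Real.log L) (show 0 < ε / 2 by linarith)
  have hrate' := (tendsto_add_atTop_nat p₀).eventually hrate
  have hz' : ∀ᶠ j in atTop,
      ((Real.log lamS + β * Real.log lamU) / (1 + β) - ε / 2) *
        (((nH (2 * (p₀ + (j + 1))) + returnTime nH nT (2 * p₀) (2 * (j + 1)) : ℕ) : ℝ) -
          ((nH (2 * (p₀ + j)) + returnTime nH nT (2 * p₀) (2 * j) : ℕ) : ℝ)) ≤
      z (j + 1) - z j := by
    filter_upwards [hrate'] with j hj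
    rw [add_comm j p₀] at hj
    have hm := hw0 (p₀ + j) (by omega)
    have h2 := Real.log_le_log (by positivity) (hw (p₀ + j) (by omega))
    rw [Real.log_mul (by positivity) (by positivity), Real.log_mul (by positivity) (by positivity),
      Real.log_div (by positivity) (by positivity), Real.log_one,
      Real.log_mul (by positivity) (by positivity), Real.log_mul (by positivity) (by positivity),
      Real.log_mul (by positivity) (by positivity), Real.log_pow, Real.log_pow, Real.log_pow,
      Real.log_pow] at h2
    rw [returnTime_two_mul_succ]
    push_cast
    have h3 : 0 ≤ Real.log 8 := Real.log_nonneg (by norm_num)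
    have h4 : 0 ≤ Real.log 8 * (nT (2 * (p₀ + j)) + nT (2 * (p₀ + j) + 1) : ℝ) := by positivity
    simp only [hz, show 2 * (p₀ + (j + 1)) = 2 * (p₀ + j) + 2 by ring]
    refine le_trans (le_trans (le_of_eq (by ring)) hj) ?_
    linarith
  have hfin := eventually_sub_le_div hτ' hz' a (show 0 < ε / 2 by linarith)
  refine hτ.frequently (Eventually.frequently ?_)
  filter_upwards [hfin, hτ'.eventually_gt_atTop 0] with j hj hposj
  refine le_trans (le_trans (le_of_eq (by ring)) hj) (le_trans ?_ (he j))
  have hm := hw0 (p₀ + j) (by omega)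
  have h5 : lamU ^ nH (2 * (p₀ + j)) * |w (2 * (p₀ + j)) 1| ≤
      ‖diagMap (lamS ^ nH (2 * (p₀ + j))) (lamU ^ nH (2 * (p₀ + j))) (w (2 * (p₀ + j)))‖ := by
    refine le_trans (le_of_eq ?_) (abs_apply_le_norm _ 1)
    rw [diagMap_apply_one, abs_mul, abs_of_pos (pow_pos hu _)]
  have h9 := Real.log_le_log (by positivity) h5
  rw [Real.log_mul (by positivity) hm.ne', Real.log_pow] at h9
  refine div_le_div_of_nonneg_right ?_ hposj.le
  simp only [hz]
  linarith

end Growth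

/-! ### The wandering boxes -/

section Boxes

variable {M : Type*} [TopologicalSpace M] [ChartedSpace Plane M]

/-- Tangency in coordinates: the derivative of the representative maps the vertical direction to the
horizontal one. -/
lemma exists_fderiv_rep_eq_smul_vS {φ : OpenPartialHomeomorph M Plane}
    (hφ : φ.MDifferentiable (𝓡 2) (𝓡 2)) {F : M → M} (hF : MDifferentiable (𝓡 2) (𝓡 2) F) {x : M}
    (hx : x ∈ φ.source) (hFx : F x ∈ φ.source)
    (hd : DifferentiableAt ℝ (rep φ φ F) (φ x)) {c : ℝ}
    (h : mfderiv (𝓡 2) (𝓡 2) F x (coordVector φ x vU) = c • coordVector φ (F x) vS) :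
    fderiv ℝ (rep φ φ F) (φ x) vU = c • vS := by
  apply coordVector_injective hφ hFx
  rw [← mfderiv_coordVector hφ hF hx hFx hd.hasFDerivAt, h]
  exact ((mfderiv (𝓡 2) (𝓡 2) φ (F x)).inverse.map_smul c vS).symm

variable [CompactSpace M] [T2Space M] {r : WithTop ℕ∞} [IsManifold (𝓡 2) r M]

/-- From some index on, each return maps the box around `ζ k` into the box around `ζ (k + 1)`, with
the derivative bounds needed to follow tangent vectors. -/
lemma exists_boxes (hr : 2 ≤ r) (f : Diffeomorph (𝓡 2) (𝓡 2) M M r) {nH nT : ℕ → ℕ} {ζ : ℕ → M}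
    {φ : OpenPartialHomeomorph M Plane} {K' : Set M} {lamS lamU α β : ℝ}
    (hn : ReturnTimes nH nT) (hDH : DH f nH nT ζ) (hH : H r f φ K' lamS lamU nH ζ)
    (hQT : QT f φ nH nT ζ) (hOE : OE nH lamS lamU α β) :
    ∃ K : Set Plane, IsCompact K ∧ K ⊆ φ.target ∧ ∃ L κ δ γ : ℝ, ∃ p₀ : ℕ,
      1 ≤ L ∧ κ ≤ Real.log lamU / 100 ∧ κ ≤ (Real.log lamU - Real.log lamS) * γ / 100 ∧ 1 ≤ p₀ ∧
      (∀ k ≥ 2 * p₀, GoodScale nH nT (Real.log L) κ δ k) ∧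
      (∀ p ≥ p₀, γ * nH (2 * p) ≤
        (nH (2 * p) : ℝ) / 4 - nH (2 * p + 1) + 3 / 4 * nH (2 * p + 2)) ∧
      (∀ k, 2 * p₀ ≤ k →
        box (φ (ζ k)) (halfWidth lamS lamU (nH k)) (halfHeight lamS lamU (nH k)) ⊆ K) ∧
      ∀ k, 2 * p₀ ≤ k →
        ∀ p ∈ box (φ (ζ k)) (halfWidth lamS lamU (nH k)) (halfHeight lamS lamU (nH k)),
        p ∈ repDomain φ φ f^[nH k] ∧
        HasFDerivAt (rep φ φ f^[nH k]) (diagMap (lamS ^ nH k) (lamU ^ nH k)) p ∧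
        rep φ φ f^[nH k] p ∈ K ∧
        p ∈ repDomain φ φ f^[nT k + nH k] ∧
        rep φ φ f^[nT k + nH k] p ∈ box (φ (ζ (k + 1))) (halfWidth lamS lamU (nH (k + 1)))
          (halfHeight lamS lamU (nH (k + 1))) ∧
        ∃ A, NearlyTurns A (L ^ nT k) (2 * (lamS ^ nH k / lamU ^ nH k)) ∧
          HasFDerivAt (rep φ φ f^[nT k + nH k])
            (A.comp (diagMap (lamS ^ nH k) (lamU ^ nH k))) p := by
  have hr1 : 1 ≤ r := le_trans (by norm_num) hr
  have hr0 : r ≠ 0 := by rintro rfl; simp at hr1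
  have hφ := mdifferentiable_of_mem_maximalAtlas hr1 hH.chart
  have hs := hH.lamS_pos
  have hu := hH.lamU_gt
  have hu0 : 0 < lamU := by linarith
  have hl : 0 < Real.log lamU := Real.log_pos hu
  have hm : Real.log lamS < 0 := Real.log_neg hs hH.lamS_lt
  have hdis : Real.log lamS + 3 * Real.log lamU < 0 := by
    have := Real.log_neg (by positivity) hH.dissipative
    rw [Real.log_mul hs.ne' (by positivity), Real.log_pow] at this
    exact_mod_cast this
  have hlin : ∀ z ∈ φ.source, f z ∈ φ.source → φ (f z) = diagMap lamS lamU (φ z) := hH.linear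
  have hK'c : IsCompact K' := hH.closed.isCompact
  have himg : IsCompact (φ '' K') := hK'c.image_of_continuousOn (φ.continuousOn.mono hH.subset)
  obtain ⟨η, hη, hηt⟩ := himg.exists_cthickening_subset_open φ.open_target
    (by rintro _ ⟨x, hx, rfl⟩; exact φ.map_source (hH.subset hx))
  obtain ⟨δ, hδ, rfl⟩ : ∃ δ > 0, η = 2 * δ := ⟨η / 2, by linarith, by ring⟩
  obtain ⟨L, hL, hLb⟩ := exists_rep_iterate_bounds_diffeomorph hr hH.chart hK'c hH.subset f
  have hβ := hOE.beta_lt hs hu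
  obtain ⟨γ, hγ0, hγ⟩ := eventually_steepness_gain hOE hβ hn.tendsto_H
  set κ := min (Real.log lamU / 100) ((Real.log lamU - Real.log lamS) * γ / 100) with hκ
  have hκ1 : κ ≤ Real.log lamU / 100 := min_le_left _ _
  have hκ2 : κ ≤ (Real.log lamU - Real.log lamS) * γ / 100 := min_le_right _ _
  have hκ0 : 0 < κ := by
    have : 0 < Real.log lamU - Real.log lamS := by linarith
    exact lt_min (by positivity) (by positivity)
  obtain ⟨k₁, hk₁⟩ := eventually_atTop.1 (eventually_goodScale hOE hβ hn.tendsto_H hDH.ratio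
    (Real.log_nonneg hL) hκ0 hδ)
  obtain ⟨p₁, hp₁⟩ := eventually_atTop.1 hγ
  have hζ : ∀ k, 1 ≤ k → ζ k ∈ K' := fun k hk => hH.stay k hk 0 (Nat.zero_le _)
  set p₀ := max 1 (max k₁ p₁) with hp₀
  have hp1 : 1 ≤ p₀ := le_max_left _ _
  have hpk : k₁ ≤ p₀ := (le_max_left _ _).trans (le_max_right _ _)
  have hpp : p₁ ≤ p₀ := (le_max_right _ _).trans (le_max_right _ _)
  have hgood : ∀ k ≥ 2 * p₀, GoodScale nH nT (Real.log L) κ δ k := fun k hk => hk₁ k (by omega)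
  have hineq := fun k (hk : k ≥ 2 * p₀) => (hgood k hk).box_inequalities hs hu hdis hL hκ1
  refine ⟨Metric.cthickening (2 * δ) (φ '' K'), himg.cthickening, hηt, L, κ, δ, γ, p₀, hL, hκ1, hκ2,
    hp1, hgood, fun p hp => hp₁ p (by omega), fun k hk => ?_, fun k hk p hp => ?_⟩
  · refine box_subset_cthickening (mem_image_of_mem φ (hζ k (by omega))) (hineq k hk).1
      (le_trans ?_ (hineq k hk).2.1)
    exact le_mul_of_one_le_left (Real.exp_pos _).le (one_le_pow₀ hu.le)
  · have hk1 : 1 ≤ k := by omega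
    obtain ⟨i1, i2, i3, i4, i5, i6⟩ := hineq k hk
    have hret : f^[nT k] (f^[nH k] (ζ k)) = ζ (k + 1) := by
      rw [← Function.iterate_add_apply, add_comm]
      exact hDH.return_eq k hk1
    have hret' : f^[nT k + nH k] (ζ k) = ζ (k + 1) := by
      rw [Function.iterate_add_apply]; exact hret
    have hζ' : f^[nH k] (ζ k) ∈ K' := hH.stay k hk1 _ le_rfl
    have hζ'' : f^[nT k] (f^[nH k] (ζ k)) ∈ K' := by rw [hret]; exact hζ _ (by omega)
    obtain ⟨b1, b2, b3⟩ := hLb (nT k) (hn.pos_T k hk1) _ hζ' hζ''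
    obtain ⟨c, hc⟩ := hQT.tangency k hk1
    have hfT : MDifferentiable (𝓡 2) (𝓡 2) f^[nT k] :=
      (f.contMDiff.iterate (nT k)).mdifferentiable hr0
    have htan := exists_fderiv_rep_eq_smul_vS hφ hfT (hH.subset hζ') (hH.subset hζ'')
      (b2.diff _ (Metric.mem_ball_self (by positivity))) hc
    obtain ⟨j1, j2, j3, j4, j5, j6⟩ := exists_return_hasFDerivAt f.continuous hs hH.lamS_lt.le hu.le
      hlin hH.subset hηt (hH.stay k hk1) (one_le_pow₀ hL) b1 b2 b3 htan (Real.exp_pos _)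
      (Real.exp_pos _) i1 i2 i3 i4 i5 i6 hp
    rw [hret'] at j5
    exact ⟨j1, j2, box_subset_cthickening (mem_image_of_mem φ hζ') le_rfl le_rfl j3, j4, j5, j6⟩

end Boxes

end SurfaceReturns

open SurfaceReturns
theorem mainTheorem3 {M : Type*} [TopologicalSpace M] [CompactSpace M] [T2Space M]
    [ChartedSpace Plane M] [IsManifold (𝓡 2) 1 M]
    (r : WithTop ℕ∞) (hr : 2 ≤ r) [IsManifold (𝓡 2) r M]
    (g : Bundle.ContinuousRiemannianMetric Plane (fun x : M => TangentSpace (𝓡 2) x))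
    (f : Diffeomorph (𝓡 2) (𝓡 2) M M r)
    (nH nT : ℕ → ℕ) (ζ : ℕ → M) (φ : OpenPartialHomeomorph M Plane) (K' : Set M)
    (lamS lamU α β : ℝ)
    (hn : ReturnTimes nH nT)
    (hDH : DH f nH nT ζ)
    (hH : H r f φ K' lamS lamU nH ζ)
    (hQT : QT f φ nH nT ζ)
    (hOE : OE nH lamS lamU α β) :
    (α * Real.log lamU + Real.log lamS) / (1 + α) <
        (β * Real.log lamU + Real.log lamS) / (1 + β) ∧
    ∃ (U : Set M) (V : Set Plane),
      IsOpen U ∧ U.Nonempty ∧ U ⊆ φ.source ∧ IsOpen V ∧ V.Nonempty ∧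
      ∀ x ∈ U, ∀ v ∈ V, v ≠ 0 →
        (¬ ∃ l : ℝ, Tendsto (finiteTimeExponent g f x (coordVector φ x v)) atTop (𝓝 l)) ∧
        liminf (fun n => (finiteTimeExponent g f x (coordVector φ x v) n : EReal)) atTop ≤
          (((α * Real.log lamU + Real.log lamS) / (1 + α) : ℝ) : EReal) ∧
        (((β * Real.log lamU + Real.log lamS) / (1 + β) : ℝ) : EReal) ≤
          limsup (fun n => (finiteTimeExponent g f x (coordVector φ x v) n : EReal)) atTop := by
  have hr1 : 1 ≤ r := le_trans (by norm_num) hr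
  have hr0 : r ≠ 0 := by rintro rfl; simp at hr1
  have hφ := mdifferentiable_of_mem_maximalAtlas hr1 hH.chart
  have hs := hH.lamS_pos
  have hu := hH.lamU_gt
  have hu0 : 0 < lamU := by linarith
  have hl : 0 < Real.log lamU := Real.log_pos hu
  have hm : Real.log lamS < 0 := Real.log_neg hs hH.lamS_lt
  have hdis : Real.log lamS + 3 * Real.log lamU < 0 := by
    have := Real.log_neg (by positivity) hH.dissipative
    rw [Real.log_mul hs.ne' (by positivity), Real.log_pow] at this
    exact_mod_cast this
  have hα := hOE.one_lt
  have hαβ := hOE.lt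
  have hlt : (α * Real.log lamU + Real.log lamS) / (1 + α) <
      (β * Real.log lamU + Real.log lamS) / (1 + β) := by
    rw [div_lt_div_iff₀ (by linarith) (by linarith)]
    nlinarith [mul_pos (sub_pos.2 hαβ) (show 0 < Real.log lamU - Real.log lamS by linarith)]
  refine ⟨hlt, ?_⟩
  obtain ⟨K, hK, hKt, L, κ, δ, γ, p₀, hL, hκ, hκγ, hp₀, hgood, hγ, hBK, hstep⟩ :=
    exists_boxes hr f hn hDH hH hQT hOE
  obtain ⟨c, hc, C, hC, hg⟩ := exists_inner_coordVector_bounds g hr1 hH.chart hK hKt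
  set B : ℕ → Set Plane := fun k =>
    box (φ (ζ k)) (halfWidth lamS lamU (nH k)) (halfHeight lamS lamU (nH k)) with hB
  have hζ : ζ (2 * p₀) ∈ φ.source := hH.subset (hH.stay (2 * p₀) (by omega) 0 (Nat.zero_le _))
  refine ⟨φ.source ∩ φ ⁻¹' B (2 * p₀), {v | |v 0| < |v 1|},
    φ.isOpen_inter_preimage (isOpen_box _ _ _),
    ⟨ζ (2 * p₀), hζ, mem_box_self _ (Real.exp_pos _) (Real.exp_pos _)⟩, inter_subset_left,
    isOpen_lt (f := fun v : Plane => |v 0|) (g := fun v : Plane => |v 1|) (by fun_prop)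
      (by fun_prop), ⟨vU, by simp⟩, ?_⟩
  rintro x ⟨hx, hxB⟩ v hv -
  obtain ⟨D, hD0, hDstep, hDret, hDexp⟩ :=
    exists_orbit_derivatives f.continuous hBK hstep hKt hxB
  have hfn : ∀ n, MDifferentiable (𝓡 2) (𝓡 2) f^[n] := fun n =>
    (f.contMDiff.iterate n).mdifferentiable hr0
  -- `w k` is the image of `v` at the `k`-th return, in coordinates
  set w : ℕ → Plane := fun k => D (k - 2 * p₀) v with hw
  have hwstep : ∀ k ≥ 2 * p₀, ∃ A, NearlyTurns A (L ^ nT k) (2 * (lamS ^ nH k / lamU ^ nH k)) ∧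
      w (k + 1) = A (diagMap (lamS ^ nH k) (lamU ^ nH k) (w k)) := by
    intro k hk
    obtain ⟨i, rfl⟩ := Nat.exists_eq_add_of_le hk
    obtain ⟨A, hA, hDA⟩ := hDstep i
    refine ⟨A, hA, ?_⟩
    simp only [hw, show 2 * p₀ + i + 1 - 2 * p₀ = i + 1 by omega, Nat.add_sub_cancel_left, hDA]
    rfl
  have hinit : |w (2 * p₀) 0| < |w (2 * p₀) 1| := by
    simpa [hw, hD0] using hv
  have hgrow := fun p (hp : p₀ ≤ p) => vector_growth hs hH.lamS_lt.le hu hdis hL hκ hκγ hgood hγ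
    hwstep hinit hp
  have hpos : ∀ k ≥ 2 * p₀, 0 < nH k := fun k hk => hn.pos_H k (by omega)
  have hne : ∀ j, w (2 * (p₀ + j)) ≠ 0 := fun j h0 => by
    have := (hgrow (p₀ + j) (by omega)).1
    simp [h0] at this
  have hwj : ∀ j, w (2 * (p₀ + j)) = D (2 * j) v := fun j => by
    simp only [hw, show 2 * (p₀ + j) - 2 * p₀ = 2 * j by omega]
  have hkj : ∀ j, 2 * p₀ + 2 * j = 2 * (p₀ + j) := fun j => by ring
  set e := finiteTimeExponent g f x (coordVector φ x v) with he
  have hliminf : liminf (fun n => (e n : EReal)) atTop ≤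
      (((α * Real.log lamU + Real.log lamS) / (1 + α) : ℝ) : EReal) := by
    refine liminf_coe_le_of_frequently fun ε hε => ?_
    refine frequently_exponent_le hOE hs hu0 hL hn.tendsto_H hDH.ratio hpos hgood
      (fun p hp => (hgrow p hp).1) (fun p hp => (hgrow p hp).2.2) (b := Real.log C / 2)
      (fun j => ?_) hε
    obtain ⟨h1, h2, h3⟩ := hDret (2 * j)
    have hv' := hne j
    rw [hwj] at hv' ⊢
    exact (finiteTimeExponent_bounds hφ hc hC hg (hfn _) hx h1 h2 h3 hv').2
  have hlimsup : (((β * Real.log lamU + Real.log lamS) / (1 + β) : ℝ) : EReal) ≤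
      limsup (fun n => (e n : EReal)) atTop := by
    refine le_limsup_coe_of_frequently fun ε hε => ?_
    refine frequently_le_exponent hOE hs hu0 hL hn.tendsto_H hDH.ratio hpos hgood
      (fun p hp => (hgrow p hp).1) (fun p hp => (hgrow p hp).2.1) (a := Real.log c / 2)
      (fun j => ?_) hε
    obtain ⟨h1, h2, h3⟩ := hDexp (2 * j)
    rw [hkj] at h1 h2 h3
    have hv' : diagMap (lamS ^ nH (2 * (p₀ + j))) (lamU ^ nH (2 * (p₀ + j))) (w (2 * (p₀ + j))) ≠
        0 := fun h0 => by
      have h4 := (hgrow (p₀ + j) (by omega)).1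
      have h5 := congrArg (fun u : Plane => u 1) h0
      simp only [diagMap_apply_one, PiLp.zero_apply] at h5
      rcases mul_eq_zero.1 h5 with h6 | h6
      · exact (pow_pos hu0 _).ne' h6
      · simp [h6] at h4
    rw [hwj] at hv' ⊢
    exact (finiteTimeExponent_bounds hφ hc hC hg (hfn _) hx h1 h2 h3 hv').1
  refine ⟨?_, hliminf, hlimsup⟩
  rintro ⟨l, hlim⟩
  have hlim' : Tendsto (fun n => (e n : EReal)) atTop (𝓝 (l : EReal)) :=
    (continuous_coe_real_ereal.tendsto l).comp hlim
  rw [hlim'.liminf_eq, EReal.coe_le_coe_iff] at hliminf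
  rw [hlim'.limsup_eq, EReal.coe_le_coe_iff] at hlimsup
  linarith
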